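/- **Setting.** Let $\mathcal M=\mathbb P^1\setminus\{0,5^{-5},\infty\}$ with coordinate $z$, and let $(\alpha)_n$ be the Pochhammer symbol. Put $\omega_i(z)=\partial_\rho^i\Big(\sum_{n\ge0}\frac{(5\rho+1)_{5n}}{((\rho+1)_n)^5}z^{n+\rho}\Big)\Big|_{\rho=0}$ $(0\le i\le3)$ and $\mathcal T=60\sum_{n\ge0}\frac{(7/2)_{5n}}{((3/2)_n)^5}z^{n+1/2}$ for $0<|z|<5^{-5}$, $z\notin(-\infty,0]$, with principal branches; $\sqrt z,\omega_i,\mathcal T$ are continued analytically (simultaneously) in $\mathcal M$, and all functions below are multivalued functions on $\mathcal M$, i.e. given on each branch of this continuation, at the points where the norm $e^{-K}$ and the Weil–Petersson metric $G_{z\bar z}$ below are positive. Let $$e^{-K}=400\,\zeta(3)|\omega_0|^2-\tfrac56\big(\omega_3\bar\omega_0+3\omega_2\bar\omega_1+3\omega_1\bar\omega_2+\omega_0\bar\omega_3\big),\quad G_{z\bar z}=\partial_z\partial_{\bar z}K,\quad \Gamma=G_{z\bar z}^{-1}\partial_zG_{z\bar z},\quad C_{zzz}=\frac{5}{(1-5^5z)z^3}$$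 (the norm of the holomorphic three-form $\Omega$ of the mirror quintic with Yukawa coupling $C_{zzz}$, the Weil–Petersson metric, its connection, the Yukawa coupling). On sections of $T^m\otimes\mathcal L^n$ let $D_z=\partial_z+m\Gamma-n\,\partial_zK$. Here $\mathcal T\in\mathcal L^{-1}$, and $\overline D_{\bar z}\overline{\mathcal T}=\partial_{\bar z}\overline{\mathcal T}+(\partial_{\bar z}K)\overline{\mathcal T}$. Let $\chi=-200$, $c_2\cdot H=50$, $N=1$ and $$\triangle_{zz}=D_zD_z\mathcal T-\frac{e^KC_{zzz}}{G_{z\bar z}}\overline D_{\bar z}\overline{\mathcal T},\qquad \triangle^z=-\frac{\triangle_{zz}}{C_{zzz}}\in T\otimes\mathcal L,\qquad \triangle=D_z\triangle^z .$$ With $X=\partial_zK-\frac1{5z}$ (that is, $\partial_z\log(e^K|f|^2)$, $f=z^{-1/5}$) and $v=dz/d\psi$, $z=(5\psi)^{-5}$ (so $v'/v=\frac6{5z}$), let $$S^{zz}=\frac{1}{C_{zzz}}\big(2X-\partial_z\log(vG_{z\bar z})\big)\in T^2\otimes\mathcal L^2,\qquad S^z=\frac1{C_{zzz}}\big(X^2-v^{-1}\partial_z(vX)\big)\in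 T\otimes\mathcal L^2,$$ $$S=\big(S^z-\tfrac12D_zS^{zz}-\tfrac12(S^{zz})^2C_{zzz}\big)X+\tfrac12D_zS^z+\tfrac12S^{zz}S^zC_{zzz}.$$ **Amplitudes.** For $2g-2+h+n>0$ let $\mathcal F^{(g,h)}_n\in(T^*)^n\otimes\mathcal L^{2g-2+h}$ be given by $\mathcal F^{(g,h)}_0=\mathcal F^{(g,h)}$ if $2g-2+h>0$, by $$\mathcal F^{(0,0)}_3=C_{zzz},\quad\mathcal F^{(0,1)}_2=\triangle_{zz},\quad \mathcal F^{(1,0)}_1=\tfrac12\partial_z\log\Big(e^{(4-\frac{\chi}{12})K}G_{z\bar z}^{-1}(1-5^5z)^{-\frac16}z^{-1-\frac{c_2\cdot H}{12}}\Big),$$ $$\mathcal F^{(0,2)}_1=-\triangle_{zz}\triangle^z-\tfrac12C_{zzz}\triangle^z\triangle^z+\tfrac N2\partial_zK+\tfrac{75}{2(1-5^5z)},$$ and by $\mathcal F^{(g,h)}_{n+1}=D_z\mathcal F^{(g,h)}_n$. Suppose that for all $(g,h)$ with $2g-2+h>0$ $$\mathcal F^{(g,h)}=\mathcal F^{(g,h)}_{\rm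 FD}+f^{(g,h)},$$ with the following Feynman-diagram part and holomorphic ambiguity. *Feynman-diagram part.* Put $\widetilde C^{(g,h)}_{n:0}=\mathcal F^{(g,h)}_n$ if $2g-2+h+n\ge1$ and $0$ otherwise, $\widetilde C^{(0,2)}_{0:1}=-\frac N2$, $\widetilde C^{(1,0)}_{0:1}=\frac\chi{24}-1$, and in all other cases $\widetilde C^{(g,h)}_{n:m+1}=(2g-2+h+n+m)\,\widetilde C^{(g,h)}_{n:m}$. A Feynman diagram $\mathsf G$ is a finite graph with vertices $v$ labelled by $(g_v,h_v)\in\mathbb Z_{\ge0}^2$, inner edges of three kinds $E^{\rm in}_0$ (both ends dashed), $E^{\rm in}_1$ (first end solid, second end dashed), $E^{\rm in}_2$ (both ends solid), and outer edges, attached to one vertex, of two kinds $E_0^{\rm out}$ (dashed), $E_1^{\rm out}$ (solid). Let $n_v$, $m_v$ be the numbers of solid and dashed ends at $v$, and $$F_{\mathsf G}=\prod_v\widetilde C^{(g_v,h_v)}_{n_v:m_v}\cdot(-2S)^{\#E^{\rm in}_0}(-S^z)^{\#E^{\rm in}_1}(-S^{zz})^{\#E^{\rm in}_2}\triangle^{\#E^{\rm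 out}_0}(\triangle^z)^{\#E^{\rm out}_1}.$$ Let $\#A_{\mathsf G}=2^{l}\,\#\mathrm{Aut}(\mathsf G)$, where $l$ is the number of self-loops in $E^{\rm in}_0\sqcup E^{\rm in}_2$ and automorphisms act on vertices and on edges. Then $\mathcal F^{(g,h)}_{\rm FD}=-\sum_{\mathsf G}\frac1{\#A_{\mathsf G}}F_{\mathsf G}$, the finite sum over isomorphism classes of connected diagrams with $\widetilde C^{(g_v,h_v)}_{n_v:m_v}\not\equiv0$ and $n_v+m_v>0$ for all $v$, $\sum_vg_v+\#E^{\rm in}-\#V+1=g$ and $\sum_vh_v+\#E^{\rm out}=h$. *Holomorphic ambiguity.* There are polynomials $a,c\in\mathbb C[z]$ (depending on $(g,h)$) such that $f^{(g,h)}$ equals: for $h=0$, $\frac{a(z)}{(1-5^5z)^{2g-2}}+c(z)$ with $\deg a\le2g-1$, $\deg c\le\lfloor\frac{2g-2}5\rfloor$; for even $h>0$, $\frac{a(z)}{(1-5^5z)^{2g-2+h}}$ with $\deg a\le3g-3+\frac{3h}2$; for odd $h$, $\frac{\sqrt z\,a(z)}{(1-5^5z)^{2g-2+h}}$ with $\deg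 a\le3g-3+\frac{3h-1}2$. **The ring.** With $\theta_z=z\partial_z$ let $$A_p=\frac{\theta_z^pG_{z\bar z}}{G_{z\bar z}},\quad B_p=\frac{\theta_z^pe^{-K}}{e^{-K}},\quad Q_p=z^{\frac12}\theta_z^p\mathcal T,\quad R_1=z^{\frac52}\frac{e^KC_{zzz}}{G_{z\bar z}}\overline D_{\bar z}\overline{\mathcal T},\quad R_2=z^{\frac72}e^KC_{zzz}\overline{\mathcal T},$$ and $I=\mathbb C(z)[A_1,B_1,B_2,B_3,Q_0,Q_1,Q_2,Q_3,R_1,R_2]$; a multivalued function lies in $I$ if one polynomial over $\mathbb C(z)$ in these generators represents it on all branches (off the poles of the coefficients). **Lemma.** For all $g,h,n\ge0$ with $2g-2+h+n>0$, $$\mathcal F^{(g,h)}_n\in z^{\frac h2}\,I .$$ Hence $P^{(g,h)}_n\in I$ for all $g,h,n\ge 0$, where $P^{(g,h)}_n=(z^3C_{zzz})^{g+h-1}z^{\frac h2}\mathcal F^{(g,h)}_n$ if $2g-2+h+n>0$ and $P^{(g,h)}_n=0$ otherwise. -/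

import Mathlib

open Complex Filter Topology

noncomputable section

namespace OpenBModel

/-! ### The moduli space, periods, and analytic continuation -/

/-- The complex moduli space `ℙ¹ ∖ {0, 5⁻⁵, ∞}` of the mirror quintic, in the coordinate `z`. -/
def Mcpl : Set ℂ := {z | z ≠ 0 ∧ 1 - 5 ^ 5 * z ≠ 0}

/-- The slit punctured disc `0 < |z| < 5⁻⁵`, `z ∉ (-∞, 0]`, on which the series below converge
and the principal branches of the powers of `z` are used. -/
def baseDomain : Set ℂ := {z | z ∈ slitPlane ∧ ‖z‖ < (5 ^ 5 : ℝ)⁻¹}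

/-- The Pochhammer symbol `(α)_n = α (α + 1) ⋯ (α + n - 1)`. -/
def poch (α : ℂ) (n : ℕ) : ℂ := (ascPochhammer ℂ n).eval α

/-- The Frobenius series `∑ₙ (5ρ+1)_{5n} / ((ρ+1)_n)⁵ z^{n+ρ}`. -/
def frobenius (ρ z : ℂ) : ℂ :=
  ∑' n : ℕ, poch (5 * ρ + 1) (5 * n) / poch (ρ + 1) n ^ 5 * z ^ ((n : ℂ) + ρ)

/-- The holomorphic functions from which everything is built: a square root of `z`, the periods
`ω₀, …, ω₃` and the series `τ` that solves the inhomogeneous Picard–Fuchs equation. -/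
structure HolData where
  sqrtz : ℂ → ℂ
  ω : Fin 4 → ℂ → ℂ
  τ : ℂ → ℂ

/-- The functions on the slit disc: `√z` (principal branch), `ω_i = ∂_ρ^i (∑ₙ …)|_{ρ = 0}`, and
`τ(z) = ∑ₙ (7/2)_{5n} / ((3/2)_n)⁵ z^{n+1/2}`. -/
def baseData : HolData where
  sqrtz z := z ^ (1 / 2 : ℂ)
  ω i z := iteratedDeriv (i : ℕ) (fun ρ : ℂ => frobenius ρ z) 0
  τ z := ∑' n : ℕ, poch (7 / 2) (5 * n) / poch (3 / 2) n ^ 5 * z ^ ((n : ℂ) + 1 / 2)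

/-- Function elements `(U, d)` obtained from `(baseDomain, baseData)` by (simultaneous) analytic
continuation inside `Mcpl`, along finite chains of connected open sets. -/
inductive IsContinuation : Set ℂ → HolData → Prop
  | base : IsContinuation baseDomain baseData
  | step {U U' : Set ℂ} {d d' : HolData} (h : IsContinuation U d)
      (hopen : IsOpen U') (hconn : IsConnected U') (hsub : U' ⊆ Mcpl)
      (hs : AnalyticOnNhd ℂ d'.sqrtz U') (hω : ∀ i, AnalyticOnNhd ℂ (d'.ω i) U')
      (hτ : AnalyticOnNhd ℂ d'.τ U') (z₀ : ℂ) (hz : z₀ ∈ U) (hz' : z₀ ∈ U')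
      (es : d.sqrtz =ᶠ[𝓝 z₀] d'.sqrtz) (eω : ∀ i, d.ω i =ᶠ[𝓝 z₀] d'.ω i)
      (eτ : d.τ =ᶠ[𝓝 z₀] d'.τ) : IsContinuation U' d'

/-- A branch of the multivalued functions `√z, ω_i, τ` on a connected open set of `Mcpl`. The
(multivalued) sections over `Mcpl` are families of functions indexed by the branches. -/
structure Branch extends HolData where
  U : Set ℂ
  isContinuation : IsContinuation U toHolData

/-! ### Wirtinger derivatives -/

/-- `∂_z = (∂_x - i ∂_y) / 2`. -/
def dz (f : ℂ → ℂ) (z : ℂ) : ℂ := (1 / 2) * (fderiv ℝ f z 1 - I * fderiv ℝ f z I)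

/-- `∂_{z̄} = (∂_x + i ∂_y) / 2`. -/
def dzbar (f : ℂ → ℂ) (z : ℂ) : ℂ := (1 / 2) * (fderiv ℝ f z 1 + I * fderiv ℝ f z I)

/-- `θ_z = z ∂_z`. -/
def θ (f : ℂ → ℂ) (z : ℂ) : ℂ := z * dz f z

/-! ### Special Kähler geometry -/

/-- The Yukawa coupling `C_{zzz} = 5 / ((1 - 5⁵ z) z³)`. -/
def Czzz (z : ℂ) : ℂ := 5 / ((1 - 5 ^ 5 * z) * z ^ 3)

/-- The Euler number `χ = -200` of the quintic. -/
def χ : ℂ := -200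

/-- `c₂ · H = 50`. -/
def c₂H : ℂ := 50

/-- `N = 1`. -/
def N : ℂ := 1

namespace Branch

variable (b : Branch)

/-- `e^{-K} = (Ω, Ω̄)`, the Hermitian norm square of the holomorphic three-form, in terms of the
periods:
`400 ζ(3) |ω₀|² - (5/6) (ω₃ ω̄₀ + 3 ω₂ ω̄₁ + 3 ω₁ ω̄₂ + ω₀ ω̄₃)`.
Here `Ω` is normalized so that its Yukawa coupling is `Czzz`. -/
def expNegK (z : ℂ) : ℝ :=
  400 * (riemannZeta 3).re * ‖b.ω 0 z‖ ^ 2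
    - (5 / 3) * (b.ω 3 z * starRingEnd ℂ (b.ω 0 z)).re
    - 5 * (b.ω 2 z * starRingEnd ℂ (b.ω 1 z)).re

/-- The Kähler potential `K = - log (Ω, Ω̄)`. -/
def K (z : ℂ) : ℝ := - Real.log (b.expNegK z)

/-- `K` as a complex-valued function. -/
def Kc (z : ℂ) : ℂ := (b.K z : ℂ)

/-- `e^K`. -/
def expK (z : ℂ) : ℂ := Complex.exp (b.Kc z)

/-- The Weil–Petersson metric `G_{z z̄} = ∂_z ∂_{z̄} K`. -/
def G (z : ℂ) : ℂ := dz (dzbar b.Kc) z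

/-- The points of the branch at which `(Ω, Ω̄)` and `G_{z z̄}` are positive, i.e. at which `K` and
the Kähler metric are defined. -/
def dom : Set ℂ := {z | z ∈ b.U ∧ 0 < b.expNegK z ∧ 0 < (b.G z).re}

/-- `Γ_{zz}^z = G^{z z̄} ∂_z G_{z z̄}`. -/
def Γ (z : ℂ) : ℂ := (b.G z)⁻¹ * dz b.G z

/-- The covariant derivative `D_z = ∂_z + m Γ_{zz}^z + n (- ∂_z K)` on `T^m ⊗ 𝓛^n`. -/
def D (m n : ℤ) (f : ℂ → ℂ) (z : ℂ) : ℂ :=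
  dz f z + (m : ℂ) * b.Γ z * f z + (n : ℂ) * (- dz b.Kc z) * f z

/-- `𝒯 = 60 τ`, a section of `𝓛^*`. -/
def T (z : ℂ) : ℂ := 60 * b.τ z

/-- `D̄_{z̄} 𝒯̄ = ∂_{z̄} 𝒯̄ + (∂_{z̄} K) 𝒯̄`. -/
def DbarTbar (z : ℂ) : ℂ :=
  dzbar (fun w => starRingEnd ℂ (b.T w)) z + dzbar b.Kc z * starRingEnd ℂ (b.T z)

/-- The disk amplitude with two insertions
`Δ_{zz} = D_z D_z 𝒯 - (e^K C_{zzz} / G_{z z̄}) D̄_{z̄} 𝒯̄`. -/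
def Δzz (z : ℂ) : ℂ :=
  b.D (-1) (-1) (b.D 0 (-1) b.T) z - b.expK z * Czzz z / b.G z * b.DbarTbar z

/-! ### Propagators and terminators -/

/-- `∂_z log (e^K |f|²)` for `f = z^{-1/5}`, for which `f'/f = -1/(5z)`. -/
def dlogKf (z : ℂ) : ℂ := dz b.Kc z + -1 / (5 * z)

/-- `v'/v = 6/(5z)` for `v = dz/dψ`, where `z = (5ψ)⁻⁵`, i.e. `v = -25 z^{6/5}`. -/
def dlogv (z : ℂ) : ℂ := 6 / (5 * z)

/-- `S^{zz} = (1/C_{zzz}) (2 ∂_z log (e^K |f|²) - ∂_z log (v G_{z z̄}))`. -/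
def Szz (z : ℂ) : ℂ :=
  1 / Czzz z * (2 * b.dlogKf z - (dlogv z + dz b.G z / b.G z))

/-- `S^z = (1/C_{zzz}) ((∂_z log (e^K |f|²))² - v⁻¹ ∂_z (v ∂_z log (e^K |f|²)))`. -/
def Sz (z : ℂ) : ℂ :=
  1 / Czzz z * (b.dlogKf z ^ 2 - (dlogv z * b.dlogKf z + dz b.dlogKf z))

/-- `S = (S^z - ½ D_z S^{zz} - ½ (S^{zz})² C_{zzz}) ∂_z log (e^K |f|²) + ½ D_z S^z
+ ½ S^{zz} S^z C_{zzz}`, where `S^{zz} ∈ T² ⊗ 𝓛²` and `S^z ∈ T ⊗ 𝓛²`. -/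
def S (z : ℂ) : ℂ :=
  (b.Sz z - 1 / 2 * b.D 2 2 b.Szz z - 1 / 2 * b.Szz z ^ 2 * Czzz z) * b.dlogKf z
    + 1 / 2 * b.D 1 2 b.Sz z + 1 / 2 * b.Szz z * b.Sz z * Czzz z

/-- `Δ^z = - Δ_{zz} / C_{zzz}`, a section of `T ⊗ 𝓛`. -/
def Δz (z : ℂ) : ℂ := - b.Δzz z / Czzz z

/-- `Δ = D_z Δ^z`. -/
def Δ (z : ℂ) : ℂ := b.D 1 1 b.Δz z

/-! ### The amplitudes -/

/-- `𝓕^{(1,0)}_1 = ½ ∂_z log (e^{(4-χ/12)K} G⁻¹ (1 - 5⁵z)^{-1/6} z^{-1-c₂H/12})`, with the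
logarithmic derivative of the product written out. -/
def F10 (z : ℂ) : ℂ :=
  1 / 2 * ((4 - χ / 12) * dz b.Kc z - dz b.G z / b.G z
    + (-1 / 6) * (-5 ^ 5 / (1 - 5 ^ 5 * z)) + (-1 - c₂H / 12) * (1 / z))

/-- `𝓕^{(0,2)}_1 = - Δ_{zz} Δ^z - ½ C_{zzz} Δ^z Δ^z + (N/2) ∂_z K + 75 / (2 (1 - 5⁵z))`. -/
def F02 (z : ℂ) : ℂ :=
  - b.Δzz z * b.Δz z - 1 / 2 * Czzz z * b.Δz z * b.Δz z + N / 2 * dz b.Kc z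
    + 75 / (2 * (1 - 5 ^ 5 * z))

/-- `𝓕^{(g,h)}_n`, a section of `(T^*)^n ⊗ 𝓛^{2g-2+h}`, for `2g - 2 + h + n > 0` (and `0` for the
other indices). Here `F g h = 𝓕^{(g,h)}` for `2g - 2 + h > 0`; `𝓕^{(0,0)}_3`, `𝓕^{(0,1)}_2`,
`𝓕^{(1,0)}_1`, `𝓕^{(0,2)}_1` are given; and `𝓕^{(g,h)}_{n+1} = D_z 𝓕^{(g,h)}_n`. -/
def amp (F : ℕ → ℕ → ℂ → ℂ) (g h : ℕ) : ℕ → ℂ → ℂ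
  | 0 => if 3 ≤ 2 * g + h then F g h else 0
  | n + 1 =>
      if 2 * g + h + (n + 1) < 3 then 0
      else if g = 0 ∧ h = 0 ∧ n + 1 = 3 then Czzz
      else if g = 0 ∧ h = 1 ∧ n + 1 = 2 then b.Δzz
      else if g = 1 ∧ h = 0 ∧ n + 1 = 1 then b.F10
      else if g = 0 ∧ h = 2 ∧ n + 1 = 1 then b.F02
      else b.D (-(n : ℤ)) (2 * (g : ℤ) - 2 + h) (amp F g h n)

/-- The vertex factors `C̃^{(g,h)}_{n:m}`. -/
def vertexFactor (F : ℕ → ℕ → ℂ → ℂ) (g h n : ℕ) : ℕ → ℂ → ℂ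
  | 0 => if 3 ≤ 2 * g + h + n then b.amp F g h n else 0
  | m + 1 =>
      if g = 0 ∧ h = 2 ∧ n = 0 ∧ m = 0 then fun _ => - N / 2
      else if g = 1 ∧ h = 0 ∧ n = 0 ∧ m = 0 then fun _ => χ / 24 - 1
      else fun z => (2 * (g : ℂ) - 2 + h + n + m) * vertexFactor F g h n m z

end Branch

/-! ### Feynman diagrams -/

/-- A Feynman diagram: vertices labelled by `(g_v, h_v)`, three kinds of inner edges and two kinds
of outer edges. Vertices and edges are numbered; diagrams are considered up to isomorphism. -/
structure Diagram where
  nV : ℕ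
  label : Fin nV → ℕ × ℕ
  nIn₀ : ℕ
  nIn₁ : ℕ
  nIn₂ : ℕ
  nOut₀ : ℕ
  nOut₁ : ℕ
  jIn₀ : Fin nIn₀ → Sym2 (Fin nV)
  jIn₁ : Fin nIn₁ → Fin nV × Fin nV
  jIn₂ : Fin nIn₂ → Sym2 (Fin nV)
  jOut₀ : Fin nOut₀ → Fin nV
  jOut₁ : Fin nOut₁ → Fin nV

namespace Diagram

/-- An isomorphism of diagrams: bijections of the vertices and of the edges of each kind that
respect the labels and the incidence maps. -/
structure Iso (A B : Diagram) where
  V : Fin A.nV ≃ Fin B.nV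
  In₀ : Fin A.nIn₀ ≃ Fin B.nIn₀
  In₁ : Fin A.nIn₁ ≃ Fin B.nIn₁
  In₂ : Fin A.nIn₂ ≃ Fin B.nIn₂
  Out₀ : Fin A.nOut₀ ≃ Fin B.nOut₀
  Out₁ : Fin A.nOut₁ ≃ Fin B.nOut₁
  label_eq : ∀ v, B.label (V v) = A.label v
  jIn₀_eq : ∀ e, B.jIn₀ (In₀ e) = (A.jIn₀ e).map V
  jIn₁_eq : ∀ e, B.jIn₁ (In₁ e) = (A.jIn₁ e).map V V
  jIn₂_eq : ∀ e, B.jIn₂ (In₂ e) = (A.jIn₂ e).map V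
  jOut₀_eq : ∀ e, B.jOut₀ (Out₀ e) = V (A.jOut₀ e)
  jOut₁_eq : ∀ e, B.jOut₁ (Out₁ e) = V (A.jOut₁ e)

/-- The identity isomorphism. -/
def Iso.refl (A : Diagram) : Iso A A where
  V := Equiv.refl _
  In₀ := Equiv.refl _
  In₁ := Equiv.refl _
  In₂ := Equiv.refl _
  Out₀ := Equiv.refl _
  Out₁ := Equiv.refl _
  label_eq _ := rfl
  jIn₀_eq e := by simp
  jIn₁_eq e := by simp
  jIn₂_eq e := by simp
  jOut₀_eq _ := rfl
  jOut₁_eq _ := rfl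

/-- The composition of two isomorphisms. -/
def Iso.trans {A B C : Diagram} (f : Iso A B) (k : Iso B C) : Iso A C where
  V := f.V.trans k.V
  In₀ := f.In₀.trans k.In₀
  In₁ := f.In₁.trans k.In₁
  In₂ := f.In₂.trans k.In₂
  Out₀ := f.Out₀.trans k.Out₀
  Out₁ := f.Out₁.trans k.Out₁
  label_eq v := by simp [k.label_eq, f.label_eq]
  jIn₀_eq e := by simp [k.jIn₀_eq, f.jIn₀_eq, Sym2.map_map]
  jIn₁_eq e := by simp [k.jIn₁_eq, f.jIn₁_eq, Prod.map_map]
  jIn₂_eq e := by simp [k.jIn₂_eq, f.jIn₂_eq, Sym2.map_map]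
  jOut₀_eq e := by simp [k.jOut₀_eq, f.jOut₀_eq]
  jOut₁_eq e := by simp [k.jOut₁_eq, f.jOut₁_eq]

/-- The inverse of an isomorphism. -/
def Iso.symm {A B : Diagram} (f : Iso A B) : Iso B A where
  V := f.V.symm
  In₀ := f.In₀.symm
  In₁ := f.In₁.symm
  In₂ := f.In₂.symm
  Out₀ := f.Out₀.symm
  Out₁ := f.Out₁.symm
  label_eq v := by simpa using (f.label_eq (f.V.symm v)).symm
  jIn₀_eq e := by
    have := f.jIn₀_eq (f.In₀.symm e)
    rw [Equiv.apply_symm_apply] at this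
    simp [this, Sym2.map_map]
  jIn₁_eq e := by
    have := f.jIn₁_eq (f.In₁.symm e)
    rw [Equiv.apply_symm_apply] at this
    simp [this, Prod.map_map]
  jIn₂_eq e := by
    have := f.jIn₂_eq (f.In₂.symm e)
    rw [Equiv.apply_symm_apply] at this
    simp [this, Sym2.map_map]
  jOut₀_eq e := by
    have := f.jOut₀_eq (f.Out₀.symm e)
    rw [Equiv.apply_symm_apply] at this
    simp [this]
  jOut₁_eq e := by
    have := f.jOut₁_eq (f.Out₁.symm e)
    rw [Equiv.apply_symm_apply] at this
    simp [this]

/-- Being isomorphic is an equivalence relation. -/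
instance isoSetoid : Setoid Diagram where
  r A B := Nonempty (Iso A B)
  iseqv := ⟨fun A => ⟨Iso.refl A⟩, fun ⟨f⟩ => ⟨f.symm⟩, fun ⟨f⟩ ⟨k⟩ => ⟨f.trans k⟩⟩

/-- Isomorphism classes of diagrams. -/
def IsoClass : Type := Quotient isoSetoid

variable (A : Diagram)

/-- The number `#L₀ + #L₂` of self-loops of the kinds `E₀^in` and `E₂^in`. -/
def numLoops : ℕ :=
  (Finset.univ.filter fun e => (A.jIn₀ e).IsDiag).card
    + (Finset.univ.filter fun e => (A.jIn₂ e).IsDiag).card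

/-- `#A_G = 2^{#L₀ + #L₂} · #Aut(G)`. -/
def symmetryFactor : ℕ := 2 ^ A.numLoops * Nat.card (Iso A A)

/-- `n_v`, the number of ends of solid lines at `v`: edges of `E₂^in` (loops count twice), edges of
`E₁^in` starting at `v`, and edges of `E₁^out`. -/
def nval (v : Fin A.nV) : ℕ :=
  (Finset.univ.filter fun e => v ∈ A.jIn₂ e).card
    + (Finset.univ.filter fun e => A.jIn₂ e = s(v, v)).card
    + (Finset.univ.filter fun e => (A.jIn₁ e).1 = v).card
    + (Finset.univ.filter fun e => A.jOut₁ e = v).card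

/-- `m_v`, the number of ends of dashed lines at `v`: edges of `E₀^in` (loops count twice), edges of
`E₁^in` ending at `v`, and edges of `E₀^out`. -/
def mval (v : Fin A.nV) : ℕ :=
  (Finset.univ.filter fun e => v ∈ A.jIn₀ e).card
    + (Finset.univ.filter fun e => A.jIn₀ e = s(v, v)).card
    + (Finset.univ.filter fun e => (A.jIn₁ e).2 = v).card
    + (Finset.univ.filter fun e => A.jOut₀ e = v).card

/-- The simple graph on the vertices in which two vertices are joined if there is an inner edge (of
any kind) between them. -/
def skeleton : SimpleGraph (Fin A.nV) :=
  SimpleGraph.fromRel fun v w =>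
    (∃ e, A.jIn₀ e = s(v, w)) ∨ (∃ e, A.jIn₁ e = (v, w)) ∨ (∃ e, A.jIn₂ e = s(v, w))

/-- The factor of the vertex `v`. -/
def vertexValue (b : Branch) (F : ℕ → ℕ → ℂ → ℂ) (v : Fin A.nV) : ℂ → ℂ :=
  b.vertexFactor F (A.label v).1 (A.label v).2 (A.nval v) (A.mval v)

/-- The contribution `F_G` of the diagram. -/
def value (b : Branch) (F : ℕ → ℕ → ℂ → ℂ) (z : ℂ) : ℂ :=
  (∏ v, A.vertexValue b F v z) * (-2 * b.S z) ^ A.nIn₀ * (-b.Sz z) ^ A.nIn₁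
    * (-b.Szz z) ^ A.nIn₂ * b.Δ z ^ A.nOut₀ * b.Δz z ^ A.nOut₁

/-- Membership in the set `𝔾(g,h)`: (i) the diagram is connected (and nonempty); (ii) no vertex
factor vanishes identically; (iii) genus `g` and `h` boundaries; (iv) every vertex has positive
valence. -/
structure IsMem (b : Branch) (F : ℕ → ℕ → ℂ → ℂ) (g h : ℕ) : Prop where
  connected : A.skeleton.Connected
  vertex_ne_zero : ∀ v, ∃ z ∈ b.dom, A.vertexValue b F v z ≠ 0
  genus : (∑ v, (A.label v).1) + (A.nIn₀ + A.nIn₁ + A.nIn₂) + 1 = g + A.nV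
  boundaries : (∑ v, (A.label v).2) + (A.nOut₀ + A.nOut₁) = h
  val_pos : ∀ v, 0 < A.nval v + A.mval v

end Diagram

/-- `𝓕^{(g,h)}_FD = - ∑_{G ∈ 𝔾(g,h)} F_G / #A_G`, a finite sum over isomorphism classes (`G.out`
is a representative of the class `G`). -/
def feynmanSum (b : Branch) (F : ℕ → ℕ → ℂ → ℂ) (g h : ℕ) (z : ℂ) : ℂ :=
  - ∑ᶠ (G : Diagram.IsoClass) (_ : (Quotient.out G).IsMem b F g h),
      1 / ((Quotient.out G).symmetryFactor : ℂ) * (Quotient.out G).value b F z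

/-- The form of the holomorphic ambiguity `f^{(g,h)}` (for `2g - 2 + h > 0`):
for `h = 0`, `a(z) / (1 - 5⁵z)^{2g-2} + c(z)` with `deg a ≤ 2g-1`, `deg c ≤ ⌊(2g-2)/5⌋`;
for `h > 0` even, `a(z) / (1 - 5⁵z)^{2g-2+h}` with `deg a ≤ 3g - 3 + 3h/2`;
for `h` odd, `√z a(z) / (1 - 5⁵z)^{2g-2+h}` with `deg a ≤ 3g - 3 + (3h-1)/2`. -/
def IsAmbiguity (g h : ℕ) (f : Branch → ℂ → ℂ) : Prop :=
  if h = 0 then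
    ∃ a c : Polynomial ℂ, a.natDegree ≤ 2 * g - 1 ∧ c.natDegree ≤ (2 * g - 2) / 5 ∧
      ∀ b, ∀ z ∈ b.dom, f b z = a.eval z / (1 - 5 ^ 5 * z) ^ (2 * g - 2) + c.eval z
  else if Even h then
    ∃ a : Polynomial ℂ, a.natDegree ≤ 3 * g + 3 * h / 2 - 3 ∧
      ∀ b, ∀ z ∈ b.dom, f b z = a.eval z / (1 - 5 ^ 5 * z) ^ (2 * g + h - 2)
  else
    ∃ a : Polynomial ℂ, a.natDegree ≤ 3 * g + (3 * h - 1) / 2 - 3 ∧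
      ∀ b, ∀ z ∈ b.dom,
        f b z = b.sqrtz z * a.eval z / (1 - 5 ^ 5 * z) ^ (2 * g + h - 2)

/-- `F` is a family of open/closed topological string amplitudes `𝓕^{(g,h)}` (`2g - 2 + h > 0`):
`𝓕^{(g,h)} = 𝓕^{(g,h)}_FD + f^{(g,h)}` with a holomorphic ambiguity of the above form. -/
def IsAmplitudeFamily (F : Branch → ℕ → ℕ → ℂ → ℂ) : Prop :=
  ∀ g h : ℕ, 3 ≤ 2 * g + h → ∃ f : Branch → ℂ → ℂ, IsAmbiguity g h f ∧
    ∀ b, ∀ z ∈ b.dom, F b g h z = feynmanSum b (F b) g h z + f b z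

/-! ### The polynomial ring -/

namespace Branch

variable (b : Branch)

/-- `A_p = θ_z^p G_{z z̄} / G_{z z̄}`. -/
def A (p : ℕ) (z : ℂ) : ℂ := (θ^[p] b.G) z / b.G z

/-- `B_p = θ_z^p e^{-K} / e^{-K}`. -/
def B (p : ℕ) (z : ℂ) : ℂ := (θ^[p] fun w => (b.expNegK w : ℂ)) z / (b.expNegK z : ℂ)

/-- `Q_p = z^{1/2} θ_z^p 𝒯`. -/
def Q (p : ℕ) (z : ℂ) : ℂ := b.sqrtz z * (θ^[p] b.T) z

/-- `R₁ = z^{5/2} (e^K C_{zzz} / G_{z z̄}) D̄_{z̄} 𝒯̄`. -/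
def R₁ (z : ℂ) : ℂ := b.sqrtz z ^ 5 * (b.expK z * Czzz z / b.G z) * b.DbarTbar z

/-- `R₂ = z^{7/2} e^K C_{zzz} 𝒯̄`. -/
def R₂ (z : ℂ) : ℂ := b.sqrtz z ^ 7 * b.expK z * Czzz z * starRingEnd ℂ (b.T z)

/-- The generators `A₁, B₁, B₂, B₃, Q₀, Q₁, Q₂, Q₃, R₁, R₂`. -/
def generator : Fin 10 → ℂ → ℂ :=
  ![b.A 1, b.B 1, b.B 2, b.B 3, b.Q 0, b.Q 1, b.Q 2, b.Q 3, b.R₁, b.R₂]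

/-- The value at `z` of a polynomial in the generators with coefficients in `ℂ(z)`. -/
def evalPoly (p : MvPolynomial (Fin 10) (RatFunc ℂ)) (z : ℂ) : ℂ :=
  ∑ m ∈ p.support, (p.coeff m).eval (RingHom.id ℂ) z * ∏ i, b.generator i z ^ m i

end Branch

/-- `f ∈ I = ℂ(z)[A₁, B₁, B₂, B₃, Q₀, …, Q₃, R₁, R₂]`: one polynomial over `ℂ(z)` represents `f` on
all branches, wherever no coefficient has a pole. -/
def MemI (f : Branch → ℂ → ℂ) : Prop :=
  ∃ p : MvPolynomial (Fin 10) (RatFunc ℂ), ∀ b : Branch, ∀ z ∈ b.dom,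
    (∀ m ∈ p.support, (p.coeff m).denom.eval z ≠ 0) → f b z = b.evalPoly p z

/-- `f ∈ z^{h/2} I`. -/
def MemHalfPowI (h : ℕ) (f : Branch → ℂ → ℂ) : Prop :=
  ∃ q : Branch → ℂ → ℂ, MemI q ∧ ∀ b, ∀ z ∈ b.dom, f b z = b.sqrtz z ^ h * q b z

/-- `𝓕^{(g,h)}_n` on every branch. -/
def amplitude (F : Branch → ℕ → ℕ → ℂ → ℂ) (g h n : ℕ) (b : Branch) : ℂ → ℂ :=
  b.amp (F b) g h n

/-- `P^{(g,h)}_n = (z³ C_{zzz})^{g+h-1} z^{h/2} 𝓕^{(g,h)}_n` if `2g - 2 + h + n > 0`, else `0`. -/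
def P (F : Branch → ℕ → ℕ → ℂ → ℂ) (g h n : ℕ) (b : Branch) (z : ℂ) : ℂ :=
  if 3 ≤ 2 * g + h + n then
    (z ^ 3 * Czzz z) ^ ((g : ℤ) + h - 1) * b.sqrtz z ^ h * amplitude F g h n b z
  else 0

end OpenBModel

end

/-!
The ring `I` is closed under `∂_z`, and all building blocks of the amplitudes are obtained from
its generators by ring operations, `∂_z` and multiplication by powers of `z^{1/2}`.

*Closure under `∂_z`.* Differentiating the generators leads to `B₄`, `Q₄` and `θ A₁`, the
derivatives of `R₁`, `R₂` being immediate from `∂_z D̄_{z̄} 𝒯̄ = G_{z z̄} 𝒯̄`. The first two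
reduce to lower ones by the Picard–Fuchs equations of the periods and of `τ`. These hold on the
slit disc because the Frobenius series `∑ₙ cₙ(ρ) z^{n+ρ}` solves the equation with right-hand side
`ρ⁴ z^ρ`, which vanishes to fourth order at `ρ = 0` and whose value at `ρ = 1/2` is `√z / 16`
(`frobSum_picardFuchs`); the derivatives in `ρ` and in `z` commute (`hasDerivAt_periodDeriv`).
They continue analytically to every branch (`IsContinuation.isRegularElement`).

*Special geometry.* The reduction of `θ A₁` (`Branch.hasDz_A_one`) rests on the bilinear
concomitant of the Picard–Fuchs operator (`concForm`). It is constant on pairs of solutions, and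
its values on the periods are found from their logarithmic behaviour at `z = 0`
(`concForm_periodDeriv`). Inverting the resulting matrix identity shows that `Ω` and `θ Ω` are
orthogonal for the symplectic form (`IsRegularElement.riemann_relation`). Complex conjugation
turns this into the vanishing of the concomitant on the pair `X = (·, Ω̄)`, `Y = (·, ∂_{z̄} Ω̄)`
of solutions (`Branch.concForm_X_Y`). As `z G_{z z̄}` is, up to sign, the Wronskian of `X` and `Y`
divided by `X²`, this linear relation and a Plücker relation between the `2 × 2` minors of the
jets of `X` and `Y` express `θ A₁` through `A₁`, `B₁`, `B₂`.

*Poles.* Only denominators `z` and `1 - 5⁵ z` occur. All functions in question are therefore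
represented by polynomials whose coefficients have no poles in the moduli space (`IsPoly`), so
that no exceptional points arise in products and derivatives.

*Feynman diagrams.* For a diagram of type `(g,h)` the numbers `2g_v - 2 + h_v + n_v + m_v` of its
vertices add up to `2g - 2 + h` (`Diagram.IsStable.sum_euler`), and each is at least `1` unless a
vertex factor vanishes identically. Hence there are finitely many diagrams, and their vertices
involve only `𝓕^{(g',h')}` with `2g' + h' < 2g + h`, so that induction applies
(`IsAmplitudeFamily.isHalf`). The powers of `z^{1/2}` match because the labels `h_v` and the outer
edges, each of which carries `Δ` or `Δ^z` in `z^{1/2} I`, add up to `h`.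
-/

namespace OpenBModel

/-! ### The Frobenius series as a function of both variables -/

/-- The coefficient `(5ρ+1)_{5n} / ((ρ+1)_n)⁵` of the Frobenius series. -/
noncomputable def frobCoeff (n : ℕ) (ρ : ℂ) : ℂ := poch (5 * ρ + 1) (5 * n) / poch (ρ + 1) n ^ 5

/-- The general term of `frobSum`. -/
noncomputable def frobTerm (k n : ℕ) (ρ z : ℂ) : ℂ :=
  frobCoeff n ρ * ((n : ℂ) + ρ) ^ k * z ^ ((n : ℂ) + ρ)

/-- The Frobenius series with `(z d/dz)^k` applied term by term. -/
noncomputable def frobSum (k : ℕ) (ρ z : ℂ) : ℂ := ∑' n : ℕ, frobTerm k n ρ z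

/-- The range of `ρ` that is used: it contains a neighbourhood of `0`, which is needed for the
periods, and the point `1 / 2`, at which the Frobenius series is `τ`. -/
def rhoDomain : Set ℂ := {ρ | -(1 / 2) < ρ.re ∧ ‖ρ‖ < 1}

lemma isOpen_rhoDomain : IsOpen rhoDomain :=
  (isOpen_lt continuous_const continuous_re).inter (isOpen_lt continuous_norm continuous_const)

lemma zero_mem_rhoDomain : (0 : ℂ) ∈ rhoDomain := by simp [rhoDomain]

lemma half_mem_rhoDomain : (1 / 2 : ℂ) ∈ rhoDomain := by
  constructor <;> norm_num

lemma closedBall_subset_rhoDomain : Metric.closedBall (0 : ℂ) (1 / 4) ⊆ rhoDomain := by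
  intro ρ h
  rw [mem_closedBall_zero_iff] at h
  have := (abs_le.1 (abs_re_le_norm ρ)).1
  exact ⟨by linarith, by linarith⟩

lemma poch_ne_zero {α : ℂ} (hα : 0 < α.re) (n : ℕ) : poch α n ≠ 0 := by
  induction n with
  | zero => simp [poch]
  | succ n ih =>
    rw [poch, ascPochhammer_succ_eval]
    refine mul_ne_zero ih fun h => ?_
    have := congrArg re h
    simp at this
    have hn : (0 : ℝ) ≤ n := n.cast_nonneg
    linarith

lemma frobCoeff_zero (ρ : ℂ) : frobCoeff 0 ρ = 1 := by simp [frobCoeff, poch]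

lemma frobCoeff_succ {ρ : ℂ} (hρ : -(1 / 2) < ρ.re) (n : ℕ) :
    frobCoeff (n + 1) ρ * ((n : ℂ) + 1 + ρ) ^ 4 =
      5 * (5 * (n + ρ) + 1) * (5 * (n + ρ) + 2) * (5 * (n + ρ) + 3) * (5 * (n + ρ) + 4)
        * frobCoeff n ρ := by
  have h0 : poch (ρ + 1) n ≠ 0 := poch_ne_zero (by simp; linarith) n
  have h1 : ρ + 1 + n ≠ 0 := fun h => by
    have := congrArg re h
    simp at this
    have hn : (0 : ℝ) ≤ n := n.cast_nonneg
    linarith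
  have e1 : poch (ρ + 1) (n + 1) = poch (ρ + 1) n * (ρ + 1 + n) := by
    rw [poch, ascPochhammer_succ_eval]; rfl
  have e2 : poch (5 * ρ + 1) (5 * (n + 1)) = poch (5 * ρ + 1) (5 * n) * (5 * (n + ρ) + 1)
      * (5 * (n + ρ) + 2) * (5 * (n + ρ) + 3) * (5 * (n + ρ) + 4) * (5 * (ρ + 1 + n)) := by
    rw [show 5 * (n + 1) = 5 * n + 1 + 1 + 1 + 1 + 1 by ring]
    simp only [poch, ascPochhammer_succ_eval]
    push_cast
    ring
  rw [frobCoeff, frobCoeff, e1, e2]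
  field_simp
  ring

lemma norm_five_mul_add_le {s : ℂ} (hs : -(1 / 2) < s.re) {j : ℝ} (h0 : 0 ≤ j) (h5 : j ≤ 5) :
    ‖5 * s + j‖ ≤ 5 * ‖s + 1‖ := by
  have : (5 : ℝ) * ‖s + 1‖ = ‖5 * (s + 1)‖ := by simp
  rw [this, ← sq_le_sq₀ (norm_nonneg _) (norm_nonneg _), ← normSq_eq_norm_sq, ← normSq_eq_norm_sq,
    normSq_apply, normSq_apply]
  simp
  nlinarith [mul_nonneg h0 (sub_nonneg.2 h5),
    mul_nonneg (sub_nonneg.2 h5) (by linarith : 0 ≤ s.re + 1 / 2)]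

/-- The ratio of consecutive coefficients has absolute value at most `5⁵` for `Re ρ > -1/2`. -/
lemma norm_frobCoeff_le {ρ : ℂ} (hρ : -(1 / 2) < ρ.re) (n : ℕ) : ‖frobCoeff n ρ‖ ≤ 3125 ^ n := by
  induction n with
  | zero => simp [frobCoeff_zero]
  | succ n ih =>
    have hn : (0 : ℝ) ≤ n := n.cast_nonneg
    have hs : -(1 / 2) < ((n : ℂ) + ρ).re := by simp; linarith
    have h1 : (0 : ℝ) < ‖(n : ℂ) + ρ + 1‖ := by
      refine norm_pos_iff.2 fun h => ?_
      have := congrArg re h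
      simp at this
      linarith
    have key := congrArg norm (frobCoeff_succ hρ n)
    rw [show (n : ℂ) + 1 + ρ = n + ρ + 1 by ring] at key
    simp only [norm_mul, norm_pow] at key
    have b1 := norm_five_mul_add_le hs (j := 1) (by norm_num) (by norm_num)
    have b2 := norm_five_mul_add_le hs (j := 2) (by norm_num) (by norm_num)
    have b3 := norm_five_mul_add_le hs (j := 3) (by norm_num) (by norm_num)
    have b4 := norm_five_mul_add_le hs (j := 4) (by norm_num) (by norm_num)
    push_cast at b1 b2 b3 b4
    have h5 : ‖(5 : ℂ)‖ = 5 := by simp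
    have : ‖frobCoeff (n + 1) ρ‖ * ‖(n : ℂ) + ρ + 1‖ ^ 4
        ≤ 3125 ^ (n + 1) * ‖(n : ℂ) + ρ + 1‖ ^ 4 := by
      rw [key, h5]
      calc _ ≤ 5 * (5 * ‖(n : ℂ) + ρ + 1‖) * (5 * ‖(n : ℂ) + ρ + 1‖) * (5 * ‖(n : ℂ) + ρ + 1‖)
            * (5 * ‖(n : ℂ) + ρ + 1‖) * 3125 ^ n := by gcongr
        _ = _ := by ring
    exact le_of_mul_le_mul_right this (by positivity)

lemma norm_cpow_le_of_mem {ρ z : ℂ} (hρ : ρ ∈ rhoDomain) (hz : z ≠ 0) (h1 : ‖z‖ ≤ 1) :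
    ‖z ^ ρ‖ ≤ ‖z‖ ^ (-(1 / 2) : ℝ) * Real.exp Real.pi := by
  rw [norm_cpow_of_ne_zero hz, div_eq_mul_inv, ← Real.exp_neg]
  have hz' : 0 < ‖z‖ := norm_pos_iff.2 hz
  refine mul_le_mul (Real.rpow_le_rpow_of_exponent_ge hz' h1 hρ.1.le) ?_ (by positivity)
    (by positivity)
  · rw [Real.exp_le_exp]
    have a := abs_arg_le_pi z
    have b : |ρ.im| ≤ 1 := (abs_im_le_norm ρ).trans hρ.2.le
    calc -(z.arg * ρ.im) ≤ |z.arg * ρ.im| := neg_le_abs _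
      _ = |z.arg| * |ρ.im| := abs_mul _ _
      _ ≤ Real.pi * 1 := by gcongr
      _ = _ := mul_one _

lemma frobTerm_eq (k n : ℕ) (ρ : ℂ) {z : ℂ} (hz : z ≠ 0) :
    frobTerm k n ρ z = z ^ ρ * (frobCoeff n ρ * ((n : ℂ) + ρ) ^ k * z ^ n) := by
  rw [frobTerm, cpow_add _ _ hz, cpow_natCast]; ring

lemma norm_frobTerm_le (k n : ℕ) {ρ z : ℂ} (hρ : ρ ∈ rhoDomain) (hz : z ≠ 0) (h1 : ‖z‖ ≤ 1) :
    ‖frobTerm k n ρ z‖ ≤ ‖z‖ ^ (-(1 / 2) : ℝ) * Real.exp Real.pi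
      * (((n : ℝ) + 1) ^ k * (3125 * ‖z‖) ^ n) := by
  rw [frobTerm_eq _ _ _ hz, norm_mul]
  refine mul_le_mul (norm_cpow_le_of_mem hρ hz h1) ?_ (norm_nonneg _) (by positivity)
  rw [norm_mul, norm_mul, norm_pow, norm_pow, mul_pow]
  have h2 : ‖(n : ℂ) + ρ‖ ≤ n + 1 := (norm_add_le _ _).trans (by simpa using hρ.2.le)
  calc _ ≤ 3125 ^ n * ((n : ℝ) + 1) ^ k * ‖z‖ ^ n := by
        gcongr
        exact norm_frobCoeff_le hρ.1 n
    _ = _ := by ring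

lemma summable_succ_pow_mul_geometric (k : ℕ) {q : ℝ} (h0 : 0 < q) (h1 : q < 1) :
    Summable fun n : ℕ => ((n : ℝ) + 1) ^ k * q ^ n := by
  have := (summable_nat_add_iff 1).2 (summable_pow_mul_geometric_of_norm_lt_one k
    (r := q) (by rwa [Real.norm_of_nonneg h0.le]))
  refine (this.mul_left q⁻¹).congr fun n => ?_
  push_cast
  rw [pow_succ']
  field_simp

/-- The slit annulus `a < |z| < q / 5⁵`. For `0 < a` and `q < 1` the estimates below are uniform on
it, and these sets exhaust the slit disc. -/
def annulus (a q : ℝ) : Set ℂ := {z | z ∈ slitPlane ∧ a < ‖z‖ ∧ 3125 * ‖z‖ < q}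

lemma isOpen_annulus (a q : ℝ) : IsOpen (annulus a q) :=
  isOpen_slitPlane.inter ((isOpen_lt continuous_const continuous_norm).inter
    (isOpen_lt (continuous_const.mul continuous_norm) continuous_const))

lemma annulus_ne_zero {a q : ℝ} {z : ℂ} (h : z ∈ annulus a q) : z ≠ 0 := slitPlane_ne_zero h.1

lemma annulus_norm_le_one {a q : ℝ} (hq : q ≤ 1) {z : ℂ} (h : z ∈ annulus a q) : ‖z‖ ≤ 1 := by
  have := h.2.2
  linarith [norm_nonneg z]

lemma exists_annulus {z : ℂ} (hz : z ∈ baseDomain) :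
    ∃ a q : ℝ, 0 < a ∧ 0 < q ∧ q < 1 ∧ z ∈ annulus a q := by
  have h0 : 0 < ‖z‖ := norm_pos_iff.2 (slitPlane_ne_zero hz.1)
  have h1 : 3125 * ‖z‖ < 1 := by
    have := hz.2
    norm_num at this
    linarith
  refine ⟨‖z‖ / 2, (3125 * ‖z‖ + 1) / 2, by positivity, by positivity, by linarith, hz.1,
    by linarith, by linarith⟩

lemma annulus_subset {a q : ℝ} (hq : q < 1) : annulus a q ⊆ baseDomain := by
  intro z h
  refine ⟨h.1, ?_⟩
  have := h.2.2
  norm_num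
  linarith

/-- The general term of a majorant of `frobSum k` on `annulus a q`. -/
noncomputable def majorant (a q : ℝ) (k n : ℕ) : ℝ :=
  a ^ (-(1 / 2) : ℝ) * Real.exp Real.pi * (((n : ℝ) + 1) ^ k * q ^ n)

lemma summable_majorant (a : ℝ) {q : ℝ} (h0 : 0 < q) (h1 : q < 1) (k : ℕ) :
    Summable (majorant a q k) := (summable_succ_pow_mul_geometric k h0 h1).mul_left _

lemma norm_frobTerm_le_majorant {a q : ℝ} (ha : 0 < a) (h1 : q < 1) (k n : ℕ) {ρ z : ℂ}
    (hρ : ρ ∈ rhoDomain) (hz : z ∈ annulus a q) : ‖frobTerm k n ρ z‖ ≤ majorant a q k n := by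
  refine (norm_frobTerm_le k n hρ (annulus_ne_zero hz) (annulus_norm_le_one h1.le hz)).trans ?_
  have hz0 : 0 < ‖z‖ := ha.trans hz.2.1
  have e1 : ‖z‖ ^ (-(1 / 2) : ℝ) ≤ a ^ (-(1 / 2) : ℝ) :=
    Real.rpow_le_rpow_of_nonpos ha hz.2.1.le (by norm_num)
  have e2 : 3125 * ‖z‖ ≤ q := hz.2.2.le
  unfold majorant
  gcongr

lemma summable_frobTerm (k : ℕ) {ρ z : ℂ} (hρ : ρ ∈ rhoDomain) (hz : z ∈ baseDomain) :
    Summable fun n => frobTerm k n ρ z := by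
  obtain ⟨a, q, ha, h0, h1, hz'⟩ := exists_annulus hz
  exact .of_norm_bounded (summable_majorant a h0 h1 k)
    fun n => norm_frobTerm_le_majorant ha h1 k n hρ hz'

lemma norm_frobSum_le {a q : ℝ} (ha : 0 < a) (h0 : 0 < q) (h1 : q < 1) (k : ℕ) {ρ z : ℂ}
    (hρ : ρ ∈ rhoDomain) (hz : z ∈ annulus a q) : ‖frobSum k ρ z‖ ≤ ∑' n, majorant a q k n :=
  tsum_of_norm_bounded (summable_majorant a h0 h1 k).hasSum
    fun n => norm_frobTerm_le_majorant ha h1 k n hρ hz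

lemma hasDerivAt_frobTerm (k n : ℕ) (ρ : ℂ) {z : ℂ} (hz : z ∈ slitPlane) :
    HasDerivAt (frobTerm k n ρ) (frobTerm (k + 1) n ρ z / z) z := by
  have h := ((hasDerivAt_id z).cpow_const (c := (n : ℂ) + ρ) hz).const_mul
    (frobCoeff n ρ * ((n : ℂ) + ρ) ^ k)
  refine h.congr_deriv ?_
  have hz0 := slitPlane_ne_zero hz
  simp only [frobTerm, id, mul_one]
  rw [cpow_sub _ _ hz0, cpow_one]
  ring

lemma hasDerivAt_frobSum (k : ℕ) {ρ z : ℂ} (hρ : ρ ∈ rhoDomain) (hz : z ∈ baseDomain) :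
    HasDerivAt (frobSum k ρ) (frobSum (k + 1) ρ z / z) z := by
  obtain ⟨a, q, ha, h0, h1, hz'⟩ := exists_annulus hz
  have hd : ∀ n, DifferentiableOn ℂ (frobTerm k n ρ) (annulus a q) := fun n w hw =>
    (hasDerivAt_frobTerm k n ρ hw.1).differentiableAt.differentiableWithinAt
  have hb : ∀ n, ∀ w ∈ annulus a q, ‖frobTerm k n ρ w‖ ≤ majorant a q k n := fun n w hw =>
    norm_frobTerm_le_majorant ha h1 k n hρ hw
  have hs := summable_majorant a h0 h1 k
  have A := hasSum_deriv_of_summable_norm hs hd (isOpen_annulus a q) hb hz'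
  have B := differentiableOn_tsum_of_summable_norm hs hd (isOpen_annulus a q) hb
  have C := (B.differentiableAt ((isOpen_annulus a q).mem_nhds hz')).hasDerivAt
  refine C.congr_deriv ?_
  rw [← A.tsum_eq, frobSum, ← tsum_div_const]
  exact tsum_congr fun n => (hasDerivAt_frobTerm k n ρ hz.1).deriv

lemma differentiableOn_frobCoeff (n : ℕ) : DifferentiableOn ℂ (frobCoeff n) rhoDomain := by
  intro ρ hρ
  have h0 : poch (ρ + 1) n ^ 5 ≠ 0 := pow_ne_zero _ (poch_ne_zero (by simp; linarith [hρ.1]) n)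
  have h1 : DifferentiableAt ℂ (fun ρ => poch (5 * ρ + 1) (5 * n)) ρ :=
    (ascPochhammer ℂ (5 * n)).differentiable.differentiableAt.comp ρ (by fun_prop)
  have h2 : DifferentiableAt ℂ (fun ρ => poch (ρ + 1) n) ρ :=
    (ascPochhammer ℂ n).differentiable.differentiableAt.comp ρ (by fun_prop)
  exact (h1.div (h2.pow 5) h0).differentiableWithinAt

lemma differentiableOn_frobTerm_rho (k n : ℕ) {z : ℂ} (hz : z ≠ 0) :
    DifferentiableOn ℂ (fun ρ => frobTerm k n ρ z) rhoDomain := by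
  refine ((differentiableOn_frobCoeff n).mul ?_).mul ?_
  · fun_prop
  · intro ρ _
    exact (DifferentiableAt.const_cpow (by fun_prop) (Or.inl hz)).differentiableWithinAt

lemma differentiableOn_frobSum_rho (k : ℕ) {z : ℂ} (hz : z ∈ baseDomain) :
    DifferentiableOn ℂ (fun ρ => frobSum k ρ z) rhoDomain := by
  obtain ⟨a, q, ha, h0, h1, hz'⟩ := exists_annulus hz
  exact differentiableOn_tsum_of_summable_norm (summable_majorant a h0 h1 k)
    (fun n => differentiableOn_frobTerm_rho k n (slitPlane_ne_zero hz.1)) isOpen_rhoDomain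
    fun n ρ hρ => norm_frobTerm_le_majorant ha h1 k n hρ hz'

lemma contDiffAt_of_differentiableOn_rhoDomain {f : ℂ → ℂ} (h : DifferentiableOn ℂ f rhoDomain)
    {n : WithTop ℕ∞} : ContDiffAt ℂ n f 0 :=
  (h.analyticAt (isOpen_rhoDomain.mem_nhds zero_mem_rhoDomain)).contDiffAt

lemma norm_iteratedDeriv_le_of_rhoDomain {f : ℂ → ℂ} (h : DifferentiableOn ℂ f rhoDomain) {C : ℝ}
    (hC : ∀ ρ ∈ rhoDomain, ‖f ρ‖ ≤ C) (i : ℕ) :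
    ‖iteratedDeriv i f 0‖ ≤ (i.factorial : ℝ) / (1 / 4) ^ i * C := by
  have := norm_iteratedDeriv_le_of_forall_mem_sphere_norm_le (c := 0) (R := 1 / 4) (C := C) (f := f)
    i (by norm_num) ?_ fun ρ hρ => hC ρ (closedBall_subset_rhoDomain
      (Metric.sphere_subset_closedBall hρ))
  · refine this.trans (le_of_eq ?_); ring
  · refine DifferentiableOn.diffContOnCl (h.mono ?_)
    exact (Metric.closure_ball_subset_closedBall).trans closedBall_subset_rhoDomain

/-- A second-order Taylor estimate for `frobSum`, uniform in `ρ`. -/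
lemma exists_frobSum_taylor (k : ℕ) {z : ℂ} (hz : z ∈ baseDomain) :
    ∃ C δ : ℝ, 0 < δ ∧ ∀ w ∈ Metric.ball z δ, w ∈ baseDomain ∧ ∀ ρ ∈ rhoDomain,
      ‖frobSum k ρ w - frobSum k ρ z - frobSum (k + 1) ρ z / z * (w - z)‖ ≤ C * ‖w - z‖ ^ 2 := by
  obtain ⟨a, q, ha, h0, h1, hz'⟩ := exists_annulus hz
  obtain ⟨δ, hδ, hball⟩ := Metric.isOpen_iff.1 (isOpen_annulus a q) z hz'
  set C1 := ∑' n, majorant a q (k + 1) n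
  set C2 := ∑' n, majorant a q (k + 1 + 1) n
  refine ⟨C2 / a ^ 2 + C1 / a ^ 2, δ, hδ,
    fun w hw => ⟨annulus_subset h1 (hball hw), fun ρ hρ => ?_⟩⟩
  set g : ℂ → ℂ := fun u => frobSum (k + 1) ρ u / u with hg
  have hg' : ∀ u ∈ Metric.ball z δ, HasDerivAt g
      ((frobSum (k + 1 + 1) ρ u / u * u - frobSum (k + 1) ρ u * 1) / u ^ 2) u := fun u hu =>
    (hasDerivAt_frobSum (k + 1) hρ (annulus_subset h1 (hball hu))).div (hasDerivAt_id u)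
      (annulus_ne_zero (hball hu))
  have hbd : ∀ u ∈ Metric.ball z δ,
      ‖(frobSum (k + 1 + 1) ρ u / u * u - frobSum (k + 1) ρ u * 1) / u ^ 2‖
        ≤ C2 / a ^ 2 + C1 / a ^ 2 := fun u hu => by
    have hu0 := annulus_ne_zero (hball hu)
    have hau : a ≤ ‖u‖ := (hball hu).2.1.le
    rw [div_mul_cancel₀ _ hu0, mul_one, norm_div, norm_pow, ← add_div]
    have b1 := norm_frobSum_le ha h0 h1 (k + 1) hρ (hball hu)
    have b2 := norm_frobSum_le ha h0 h1 (k + 1 + 1) hρ (hball hu)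
    have := (norm_sub_le (frobSum (k + 1 + 1) ρ u) (frobSum (k + 1) ρ u)).trans (add_le_add b2 b1)
    have hC : 0 ≤ C2 + C1 := (norm_nonneg _).trans this
    gcongr
  have hlip : ∀ u ∈ Metric.ball z δ, ‖g u - g z‖ ≤ (C2 / a ^ 2 + C1 / a ^ 2) * ‖u - z‖ :=
    fun u hu => (convex_ball z δ).norm_image_sub_le_of_norm_hasDerivWithin_le
      (fun x hx => (hg' x hx).hasDerivWithinAt) hbd (Metric.mem_ball_self hδ) hu
  -- On the segment from `z` to `w` the derivative of the remainder is `O(‖w - z‖)`.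
  have hsub : ∀ u ∈ segment ℝ z w, u ∈ Metric.ball z δ ∧ ‖u - z‖ ≤ ‖w - z‖ := fun u hu =>
    ⟨(convex_ball z δ).segment_subset (Metric.mem_ball_self hδ) hw hu,
      by simpa [norm_sub_rev] using norm_sub_le_of_mem_segment hu⟩
  have := (convex_segment z w).norm_image_sub_le_of_norm_hasDerivWithin_le
    (f := fun u => frobSum k ρ u - g z * (u - z)) (f' := fun u => g u - g z)
    (C := (C2 / a ^ 2 + C1 / a ^ 2) * ‖w - z‖) (fun u hu => ?_) (fun u hu => ?_)
    (left_mem_segment ℝ z w) (right_mem_segment ℝ z w)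
  · rw [sub_self, mul_zero, sub_zero, mul_assoc, ← sq] at this
    rwa [sub_right_comm] at this
  · have h2 := hasDerivAt_frobSum k hρ (annulus_subset h1 (hball (hsub u hu).1))
    have h3 := h2.sub (((hasDerivAt_id u).sub_const z).const_mul (g z))
    rw [mul_one] at h3
    exact h3.hasDerivWithinAt
  · refine (hlip u (hsub u hu).1).trans ?_
    have hC : 0 ≤ C2 / a ^ 2 + C1 / a ^ 2 := (norm_nonneg _).trans (hbd z (Metric.mem_ball_self hδ))
    have := (hsub u hu).2
    gcongr

/-- `(z d/dz)^k ω_i` on the slit disc, obtained by differentiating the series term by term. -/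
noncomputable def periodDeriv (i k : ℕ) (z : ℂ) : ℂ := iteratedDeriv i (fun ρ => frobSum k ρ z) 0

/-- The derivatives in `z` and in `ρ` commute. -/
lemma hasDerivAt_periodDeriv (i k : ℕ) {z : ℂ} (hz : z ∈ baseDomain) :
    HasDerivAt (periodDeriv i k) (periodDeriv i (k + 1) z / z) z := by
  obtain ⟨C, δ, hδ, hC⟩ := exists_frobSum_taylor k hz
  rw [hasDerivAt_iff_tendsto_slope_zero, tendsto_iff_norm_sub_tendsto_zero]
  have hlim : Tendsto (fun t : ℂ => (i.factorial : ℝ) / (1 / 4) ^ i * (C * ‖t‖)) (𝓝[≠] 0)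
      (𝓝 0) := by
    have : Continuous fun t : ℂ => (i.factorial : ℝ) / (1 / 4) ^ i * (C * ‖t‖) := by fun_prop
    simpa using (this.tendsto 0).mono_left nhdsWithin_le_nhds
  refine squeeze_zero' (Eventually.of_forall fun _ => norm_nonneg _) ?_ hlim
  filter_upwards [self_mem_nhdsWithin,
    nhdsWithin_le_nhds (Metric.ball_mem_nhds (0 : ℂ) hδ)] with t h0 ht
  have h0 : t ≠ 0 := h0
  have hw : z + t ∈ Metric.ball z δ := by simpa using ht
  obtain ⟨hb, hest⟩ := hC _ hw
  have d1 := differentiableOn_frobSum_rho k hb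
  have d2 := differentiableOn_frobSum_rho k hz
  have d3 := differentiableOn_frobSum_rho (k + 1) hz
  have c1 := contDiffAt_of_differentiableOn_rhoDomain d1 (n := i)
  have c2 := contDiffAt_of_differentiableOn_rhoDomain d2 (n := i)
  have c3 := contDiffAt_of_differentiableOn_rhoDomain d3 (n := i)
  have e : t⁻¹ • (periodDeriv i k (z + t) - periodDeriv i k z) - periodDeriv i (k + 1) z / z
      = iteratedDeriv i (fun ρ => t⁻¹ * (frobSum k ρ (z + t) - frobSum k ρ z)
          - z⁻¹ * frobSum (k + 1) ρ z) 0 := by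
    rw [iteratedDeriv_fun_sub (contDiffAt_const.mul (c1.sub c2)) (contDiffAt_const.mul c3),
      iteratedDeriv_const_mul _ (c1.sub c2), iteratedDeriv_const_mul _ c3,
      iteratedDeriv_fun_sub c1 c2]
    simp only [periodDeriv, smul_eq_mul]
    ring
  rw [e]
  refine norm_iteratedDeriv_le_of_rhoDomain (((d1.sub d2).const_mul _).sub (d3.const_mul _))
    (fun ρ hρ => ?_) i
  have := hest ρ hρ
  rw [add_sub_cancel_left] at this
  have ht0 : 0 < ‖t‖ := norm_pos_iff.2 h0
  have e2 : t⁻¹ * (frobSum k ρ (z + t) - frobSum k ρ z) - z⁻¹ * frobSum (k + 1) ρ z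
      = t⁻¹ * (frobSum k ρ (z + t) - frobSum k ρ z - frobSum (k + 1) ρ z / z * t) := by
    field_simp
  simp only [Pi.sub_apply]
  rw [e2, norm_mul, norm_inv, inv_mul_le_iff₀ ht0]
  linarith

/-! ### The Picard–Fuchs equation on the slit disc -/

/-- The inhomogeneous Picard–Fuchs equation of the Frobenius series. -/
lemma frobSum_picardFuchs {ρ z : ℂ} (hρ : ρ ∈ rhoDomain) (hz : z ∈ baseDomain) :
    frobSum 4 ρ z = ρ ^ 4 * z ^ ρ + z * (3125 * frobSum 4 ρ z + 6250 * frobSum 3 ρ z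
      + 4375 * frobSum 2 ρ z + 1250 * frobSum 1 ρ z + 120 * frobSum 0 ρ z) := by
  have hs := fun k => summable_frobTerm k hρ hz
  have hz0 := slitPlane_ne_zero hz.1
  conv_lhs => rw [frobSum, (hs 4).tsum_eq_zero_add]
  congr 1
  · simp [frobTerm, frobCoeff_zero]
  · simp only [frobSum]
    rw [← tsum_mul_left, ← tsum_mul_left, ← tsum_mul_left, ← tsum_mul_left, ← tsum_mul_left,
      ← ((hs 4).mul_left _).tsum_add ((hs 3).mul_left _),
      ← (((hs 4).mul_left _).add ((hs 3).mul_left _)).tsum_add ((hs 2).mul_left _),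
      ← ((((hs 4).mul_left _).add ((hs 3).mul_left _)).add ((hs 2).mul_left _)).tsum_add
        ((hs 1).mul_left _),
      ← (((((hs 4).mul_left _).add ((hs 3).mul_left _)).add ((hs 2).mul_left _)).add
        ((hs 1).mul_left _)).tsum_add ((hs 0).mul_left _), ← tsum_mul_left]
    refine tsum_congr fun n => ?_
    have key := frobCoeff_succ hρ.1 n
    simp only [frobTerm_eq _ _ _ hz0]
    rw [pow_succ z n]
    push_cast
    linear_combination (z ^ ρ * z ^ n * z) * key

lemma tau_eq (z : ℂ) : baseData.τ z = frobSum 0 (1 / 2) z := by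
  simp only [baseData, frobSum, frobTerm, frobCoeff, pow_zero, mul_one]
  norm_num

lemma omega_eq (i : Fin 4) (z : ℂ) : baseData.ω i z = periodDeriv i 0 z := by
  simp only [baseData, periodDeriv, frobenius, frobSum, frobTerm, frobCoeff, pow_zero, mul_one]

/-! ### Holomorphic jets and the bilinear concomitant -/

/-- The holomorphic logarithmic derivative `z d/dz`. -/
noncomputable def thetaHol (f : ℂ → ℂ) (z : ℂ) : ℂ := z * deriv f z

/-- The logarithmic jet `p ↦ (z d/dz)^p f` of a holomorphic function. -/
noncomputable def jet (f : ℂ → ℂ) (z : ℂ) (p : ℕ) : ℂ := (thetaHol^[p] f) z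

@[simp] lemma jet_zero (f : ℂ → ℂ) (z : ℂ) : jet f z 0 = f z := rfl

lemma analyticOnNhd_thetaHol {f : ℂ → ℂ} {U : Set ℂ} (h : AnalyticOnNhd ℂ f U) :
    AnalyticOnNhd ℂ (thetaHol f) U := analyticOnNhd_id.mul h.deriv

lemma analyticOnNhd_jet {f : ℂ → ℂ} {U : Set ℂ} (h : AnalyticOnNhd ℂ f U) (p : ℕ) :
    AnalyticOnNhd ℂ (fun z => jet f z p) U := by
  change AnalyticOnNhd ℂ (thetaHol^[p] f) U
  induction p with
  | zero => exact h
  | succ p ih => rw [Function.iterate_succ_apply']; exact analyticOnNhd_thetaHol ih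

lemma jet_succ (f : ℂ → ℂ) (z : ℂ) (p : ℕ) :
    jet f z (p + 1) = z * deriv (fun w => jet f w p) z := by
  rw [jet, Function.iterate_succ_apply']; rfl

lemma hasDerivAt_jet {f : ℂ → ℂ} {z : ℂ} (h : AnalyticAt ℂ f z) (hz : z ≠ 0) (p : ℕ) :
    HasDerivAt (fun w => jet f w p) (jet f z (p + 1) / z) z := by
  have h1 : AnalyticOnNhd ℂ f {z} := fun w hw => by rwa [Set.mem_singleton_iff.1 hw]
  have := (analyticOnNhd_jet h1 p z rfl).differentiableAt.hasDerivAt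
  rwa [jet_succ, mul_div_cancel_left₀ _ hz]

lemma jet_congr {f g : ℂ → ℂ} {z : ℂ} (h : f =ᶠ[𝓝 z] g) (p : ℕ) :
    (fun w => jet f w p) =ᶠ[𝓝 z] fun w => jet g w p := by
  induction p with
  | zero => exact h
  | succ p ih =>
    filter_upwards [ih.deriv] with w hw
    rw [jet_succ, jet_succ, hw]

/-- The Picard–Fuchs operator applied to a jet `u`. -/
def pfForm (z : ℂ) (u : ℕ → ℂ) : ℂ :=
  u 4 - z * (3125 * u 4 + 6250 * u 3 + 4375 * u 2 + 1250 * u 1 + 120 * u 0)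

/-- The bilinear concomitant of the Picard–Fuchs operator, as an alternating form on jets. -/
def concForm (z : ℂ) (u v : ℕ → ℂ) : ℂ :=
  (1 - 3125 * z) * ((u 0 * v 3 - u 3 * v 0) - (u 1 * v 2 - u 2 * v 1))
    - 3125 * z * (u 0 * v 2 - u 2 * v 0) - 1250 * z * (u 0 * v 1 - u 1 * v 0)

/-- The concomitant of two solutions of the Picard–Fuchs equation is constant. -/
lemma hasDerivAt_concForm {z : ℂ} (hz : z ≠ 0) {u v : ℂ → ℕ → ℂ}
    (hu : ∀ p < 4, HasDerivAt (fun w => u w p) (u z (p + 1) / z) z)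
    (hv : ∀ p < 4, HasDerivAt (fun w => v w p) (v z (p + 1) / z) z)
    (pu : pfForm z (u z) = 0) (pv : pfForm z (v z) = 0) :
    HasDerivAt (fun w => concForm w (u w) (v w)) 0 z := by
  have m := fun p (hp : p < 4) q (hq : q < 4) =>
    ((hu p hp).mul (hv q hq)).sub ((hu q hq).mul (hv p hp))
  have hc := ((hasDerivAt_id z).const_mul (3125 : ℂ))
  have h := (((hc.const_sub 1).mul
    ((m 0 (by simp) 3 (by simp)).sub (m 1 (by simp) 2 (by simp)))).sub
    (hc.mul (m 0 (by simp) 2 (by simp)))).sub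
    (((hasDerivAt_id z).const_mul (1250 : ℂ)).mul (m 0 (by simp) 1 (by simp)))
  refine h.congr_deriv ?_
  simp only [pfForm, Pi.sub_apply, Pi.mul_apply, id, mul_one] at pu pv ⊢
  field_simp
  linear_combination (u z 0) * pv - (v z 0) * pu

/-- A relation among the `2 × 2` minors of the first two rows of the matrix `U` of jets. If `E` and
`κ` are the matrices of the concomitant in the jets and in the periods, then `Uᵀ E U = κ` inverts to
`U κ⁻¹ Uᵀ = E⁻¹`, and the relation is the vanishing of the entry `(1, 0)` of `E⁻¹`. -/
lemma minor_eq_of_concForm {U : Matrix (Fin 4) (Fin 4) ℂ} {p α β : ℂ} (hp : p ≠ 0)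
    (h : U.transpose * !![0, β, α, p; -β, 0, -p, 0; -α, p, 0, 0; -p, 0, 0, 0] * U
      = !![0, 0, 0, 6; 0, 0, -2, 0; 0, 2, 0, 0; -6, 0, 0, 0]) :
    U 0 0 * U 1 3 - U 1 0 * U 0 3 = 3 * (U 0 1 * U 1 2 - U 1 1 * U 0 2) := by
  set E : Matrix (Fin 4) (Fin 4) ℂ := !![0, β, α, p; -β, 0, -p, 0; -α, p, 0, 0; -p, 0, 0, 0] with hE
  set J : Matrix (Fin 4) (Fin 4) ℂ :=
    !![0, 0, 0, -1 / 6; 0, 0, 1 / 2, 0; 0, -1 / 2, 0, 0; 1 / 6, 0, 0, 0] with hJ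
  have h1 : J * (!![0, 0, 0, 6; 0, 0, -2, 0; 0, 2, 0, 0; -6, 0, 0, 0] : Matrix (Fin 4) (Fin 4) ℂ)
      = 1 := by
    ext i j
    fin_cases i <;> fin_cases j <;> simp [hJ, Matrix.mul_apply, Fin.sum_univ_four]
  have h2 : (J * U.transpose * E) * U = 1 := by
    rw [← h1, ← h]; simp only [Matrix.mul_assoc]
  have h3 : U * (J * U.transpose * E) = 1 := mul_eq_one_comm.1 h2
  have h4 := congrFun (congrFun h3 1) 3
  rw [← Matrix.mul_assoc, ← Matrix.mul_assoc] at h4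
  simp [hJ, hE, Matrix.mul_apply, Fin.sum_univ_four, hp] at h4
  linear_combination 6 * h4

/-! ### The periods near `z = 0` -/

lemma iteratedDeriv_pow_mul_cpow {z : ℂ} (hz : z ≠ 0) (i p : ℕ) :
    iteratedDeriv i (fun ρ : ℂ => ρ ^ p * z ^ ρ) 0 = i.descFactorial p * log z ^ (i - p) := by
  have hc : ∀ ρ : ℂ, HasDerivAt (fun ρ : ℂ => z ^ ρ) (log z * z ^ ρ) ρ := fun ρ => by
    simpa [mul_comm] using (hasDerivAt_id ρ).const_cpow (c := z) (Or.inl hz)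
  have hd : ∀ (i p : ℕ), ContDiffAt ℂ i (fun ρ : ℂ => ρ ^ p * z ^ ρ) 0 := fun i p => by
    have : Differentiable ℂ (fun ρ : ℂ => ρ ^ p * z ^ ρ) := fun ρ =>
      (differentiableAt_id.pow p).mul (hc ρ).differentiableAt
    exact (this.contDiff).contDiffAt
  induction i generalizing p with
  | zero => cases p <;> simp
  | succ i ih =>
    rw [iteratedDeriv_succ']
    cases p with
    | zero =>
      have : deriv (fun ρ : ℂ => ρ ^ 0 * z ^ ρ) = fun ρ => log z * (ρ ^ 0 * z ^ ρ) := by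
        ext ρ; simpa using (hc ρ).deriv
      rw [this, iteratedDeriv_const_mul _ (hd i 0), ih]
      simp [pow_succ']
    | succ p =>
      have : deriv (fun ρ : ℂ => ρ ^ (p + 1) * z ^ ρ)
          = fun ρ => (p + 1 : ℂ) * (ρ ^ p * z ^ ρ) + log z * (ρ ^ (p + 1) * z ^ ρ) := by
        ext ρ
        refine (((hasDerivAt_pow (p + 1) ρ).mul (hc ρ)).congr_deriv ?_).deriv
        push_cast
        ring
      rw [this, iteratedDeriv_fun_add (contDiffAt_const.mul (hd i p))
        (contDiffAt_const.mul (hd i (p + 1))), iteratedDeriv_const_mul _ (hd i p),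
        iteratedDeriv_const_mul _ (hd i (p + 1)), ih, ih, Nat.succ_descFactorial_succ,
        Nat.descFactorial_succ, Nat.add_sub_add_right]
      rcases lt_trichotomy i p with h | rfl | h
      · simp [Nat.descFactorial_eq_zero_iff_lt.2 h]
      · simp
      · obtain ⟨d, rfl⟩ := Nat.exists_eq_add_of_lt h
        rw [show p + d + 1 - p = d + 1 by omega, show p + d + 1 - (p + 1) = d by omega]
        push_cast
        ring

lemma periodDeriv_picardFuchs {i : ℕ} (hi : i < 4) {z : ℂ} (hz : z ∈ baseDomain) :
    pfForm z (fun k => periodDeriv i k z) = 0 := by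
  have c := fun k => contDiffAt_of_differentiableOn_rhoDomain (differentiableOn_frobSum_rho k hz)
    (n := i)
  have hz0 := slitPlane_ne_zero hz.1
  have e : iteratedDeriv i (fun ρ : ℂ => ρ ^ 4 * z ^ ρ) 0 = 0 := by
    rw [iteratedDeriv_pow_mul_cpow hz0, Nat.descFactorial_eq_zero_iff_lt.2 hi]; simp
  have e2 : (fun ρ : ℂ => ρ ^ 4 * z ^ ρ) =ᶠ[𝓝 0] fun ρ => frobSum 4 ρ z
      - z * (3125 * frobSum 4 ρ z + 6250 * frobSum 3 ρ z
      + 4375 * frobSum 2 ρ z + 1250 * frobSum 1 ρ z + 120 * frobSum 0 ρ z) := by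
    filter_upwards [isOpen_rhoDomain.mem_nhds zero_mem_rhoDomain] with ρ hρ
    linear_combination -frobSum_picardFuchs hρ hz
  have cm := fun (k : ℕ) (a : ℂ) => (contDiffAt_const (c := a)).mul (c k)
  rw [(e2.iteratedDeriv_eq i), iteratedDeriv_fun_sub (c 4) (contDiffAt_const.mul
    (((((cm 4 _).add (cm 3 _)).add (cm 2 _)).add (cm 1 _)).add (cm 0 _))),
    iteratedDeriv_const_mul _ (((((cm 4 _).add (cm 3 _)).add (cm 2 _)).add (cm 1 _)).add (cm 0 _)),
    iteratedDeriv_fun_add ((((cm 4 _).add (cm 3 _)).add (cm 2 _)).add (cm 1 _)) (cm 0 _),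
    iteratedDeriv_fun_add (((cm 4 _).add (cm 3 _)).add (cm 2 _)) (cm 1 _),
    iteratedDeriv_fun_add ((cm 4 _).add (cm 3 _)) (cm 2 _),
    iteratedDeriv_fun_add (cm 4 _) (cm 3 _),
    iteratedDeriv_const_mul _ (c 4), iteratedDeriv_const_mul _ (c 3),
    iteratedDeriv_const_mul _ (c 2), iteratedDeriv_const_mul _ (c 1),
    iteratedDeriv_const_mul _ (c 0)] at e
  exact e

/-- Near `z = 0` the jets of the periods are those of the powers of `log z`, up to
`O(|z|^{1/2})`. -/
lemma exists_norm_periodDeriv_sub_le (i p : ℕ) : ∃ C : ℝ, ∀ z ∈ slitPlane, ‖z‖ ≤ 1 / 6250 →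
    ‖periodDeriv i p z - i.descFactorial p * log z ^ (i - p)‖ ≤ C * ‖z‖ ^ (1 / 2 : ℝ) := by
  have hsum : Summable fun n : ℕ => (((n + 1 : ℕ) : ℝ) + 1) ^ p * (1 / 2 : ℝ) ^ n := by
    have := (summable_nat_add_iff 1).2 (summable_succ_pow_mul_geometric p (q := 1 / 2)
      (by norm_num) (by norm_num))
    refine (this.mul_left 2).congr fun n => ?_
    rw [pow_succ]; ring
  refine ⟨(i.factorial : ℝ) / (1 / 4) ^ i * (Real.exp Real.pi * 3125
    * ∑' n : ℕ, (((n + 1 : ℕ) : ℝ) + 1) ^ p * (1 / 2 : ℝ) ^ n), fun z hz hn => ?_⟩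
  have hzb : z ∈ baseDomain := ⟨hz, hn.trans_lt (by norm_num)⟩
  have hz0 := slitPlane_ne_zero hz
  have hpos : 0 < ‖z‖ := norm_pos_iff.2 hz0
  have d1 := differentiableOn_frobSum_rho p hzb
  have d2 : DifferentiableOn ℂ (fun ρ : ℂ => ρ ^ p * z ^ ρ) rhoDomain := fun ρ _ =>
    ((differentiableAt_id.pow p).mul
      (differentiableAt_id.const_cpow (Or.inl hz0))).differentiableWithinAt
  rw [← iteratedDeriv_pow_mul_cpow hz0, periodDeriv,
    ← iteratedDeriv_fun_sub (contDiffAt_of_differentiableOn_rhoDomain d1)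
      (contDiffAt_of_differentiableOn_rhoDomain d2), mul_assoc]
  refine norm_iteratedDeriv_le_of_rhoDomain (d1.sub d2) (fun ρ hρ => ?_) i
  have hs := summable_frobTerm p hρ hzb
  have e : frobSum p ρ z - ρ ^ p * z ^ ρ = ∑' n, frobTerm p (n + 1) ρ z := by
    rw [frobSum, hs.tsum_eq_zero_add]
    simp [frobTerm, frobCoeff_zero]
  simp only [Pi.sub_apply]
  rw [e]
  have hb : ∀ n, ‖frobTerm p (n + 1) ρ z‖ ≤ Real.exp Real.pi * 3125 * ‖z‖ ^ (1 / 2 : ℝ)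
      * ((((n + 1 : ℕ) : ℝ) + 1) ^ p * (1 / 2 : ℝ) ^ n) := fun n => by
    refine (norm_frobTerm_le p (n + 1) hρ hz0 (hn.trans (by norm_num))).trans ?_
    have h1 : (3125 * ‖z‖) ^ n ≤ (1 / 2 : ℝ) ^ n := by gcongr; linarith
    have h2 : ‖z‖ ^ (-(1 / 2) : ℝ) * ‖z‖ = ‖z‖ ^ (1 / 2 : ℝ) := by
      rw [← Real.rpow_add_one hpos.ne']; norm_num
    calc _ = Real.exp Real.pi * 3125 * (‖z‖ ^ (-(1 / 2) : ℝ) * ‖z‖)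
          * ((((n + 1 : ℕ) : ℝ) + 1) ^ p * (3125 * ‖z‖) ^ n) := by rw [pow_succ (3125 * ‖z‖)]; ring
      _ ≤ _ := by rw [h2]; gcongr
  refine (tsum_of_norm_bounded (hsum.mul_left _).hasSum hb).trans (le_of_eq ?_)
  rw [tsum_mul_left]
  ring

/-- `f` is negligible with respect to `L` if it tends to `0` even after multiplication by an
arbitrary power of `L`. -/
def Negligible {α : Type*} (l : Filter α) (L f : α → ℂ) : Prop :=
  ∀ k : ℕ, Tendsto (fun t => L t ^ k * f t) l (𝓝 0)

/-- The multipliers of the ideal of negligible functions. -/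
def Moderate {α : Type*} (l : Filter α) (L f : α → ℂ) : Prop :=
  ∀ g, Negligible l L g → Negligible l L (fun t => f t * g t)

section Negligible

variable {α : Type*} {l : Filter α} {L f g : α → ℂ}

lemma Negligible.tendsto (h : Negligible l L f) : Tendsto f l (𝓝 0) := by simpa using h 0

lemma Negligible.add (hf : Negligible l L f) (hg : Negligible l L g) :
    Negligible l L (fun t => f t + g t) := fun k => by
  simpa [mul_add] using (hf k).add (hg k)

lemma Negligible.neg (hf : Negligible l L f) : Negligible l L (fun t => -f t) := fun k => by
  simpa using (hf k).neg

lemma Negligible.sub (hf : Negligible l L f) (hg : Negligible l L g) :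
    Negligible l L (fun t => f t - g t) := by simpa only [sub_eq_add_neg] using hf.add hg.neg

lemma Negligible.moderate (hf : Negligible l L f) : Moderate l L f := fun g hg k => by
  simpa [mul_assoc, mul_comm, mul_left_comm] using hf.tendsto.mul (hg k)

lemma moderate_const (c : ℂ) : Moderate l L (fun _ => c) := fun g hg k => by
  simpa [mul_left_comm] using (hg k).const_mul c

lemma moderate_self : Moderate l L L := fun g hg k => by
  simpa [pow_succ, mul_assoc] using hg (k + 1)

lemma Moderate.add (hf : Moderate l L f) (hg : Moderate l L g) :
    Moderate l L (fun t => f t + g t) := fun h hh => by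
  simpa only [add_mul] using (hf h hh).add (hg h hh)

lemma Moderate.mul (hf : Moderate l L f) (hg : Moderate l L g) :
    Moderate l L (fun t => f t * g t) := fun h hh => by
  simpa only [mul_assoc] using hf _ (hg _ hh)

lemma Moderate.pow (hf : Moderate l L f) (n : ℕ) : Moderate l L (fun t => f t ^ n) := by
  induction n with
  | zero => simpa using moderate_const 1
  | succ n ih => simpa only [pow_succ] using ih.mul hf

lemma Moderate.sub (hf : Moderate l L f) (hg : Moderate l L g) :
    Moderate l L (fun t => f t - g t) := fun h hh => by
  simpa only [sub_mul] using (hf h hh).sub (hg h hh)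

/-- The concomitant of jets which are moderate up to negligible terms, at a negligible point. -/
lemma Negligible.concForm {w : α → ℂ} {u v a b : α → ℕ → ℂ} (hw : Negligible l L w)
    (ha : ∀ p, Moderate l L fun t => a t p) (hb : ∀ p, Moderate l L fun t => b t p)
    (hu : ∀ p, Negligible l L fun t => u t p - a t p)
    (hv : ∀ p, Negligible l L fun t => v t p - b t p) :
    Negligible l L fun t => concForm (w t) (u t) (v t)
      - ((a t 0 * b t 3 - a t 3 * b t 0) - (a t 1 * b t 2 - a t 2 * b t 1)) := by
  have prod : ∀ p q, Negligible l L fun t => u t p * v t q - a t p * b t q := fun p q => by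
    have := ((ha p _ (hv q)).add (hb q _ (hu p))).add ((hu p).moderate _ (hv q))
    refine cast (congrArg _ (funext fun t => ?_)) this
    ring
  have hab : ∀ p q, Moderate l L fun t => u t p * v t q := fun p q => by
    have := (prod p q).moderate.add ((ha p).mul (hb q))
    simpa using this
  have m : ∀ p q, Moderate l L fun t => u t p * v t q - u t q * v t p :=
    fun p q => (hab p q).sub (hab q p)
  have n1 := ((prod 0 3).sub (prod 3 0)).sub ((prod 1 2).sub (prod 2 1))
  have n2 := ((moderate_const (3125 : ℂ)).mul ((m 0 3).sub (m 1 2))) _ hw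
  have n3 := ((moderate_const (3125 : ℂ)).mul (m 0 2)) _ hw
  have n4 := ((moderate_const (1250 : ℂ)).mul (m 0 1)) _ hw
  have := ((n1.sub n2).sub n3).sub n4
  refine cast (congrArg _ (funext fun t => ?_)) this
  simp only [OpenBModel.concForm]
  ring

end Negligible

lemma tendsto_log_pow_mul_rpow (c : ℂ) (k : ℕ) {a : ℝ} (ha : 0 < a) :
    Tendsto (fun t : ℝ => ((Real.log t : ℂ) + c) ^ k * ((t ^ a : ℝ) : ℂ)) (𝓝[>] 0) (𝓝 0) := by
  have hr : ∀ {a : ℝ}, 0 < a → Tendsto (fun t : ℝ => ((t ^ a : ℝ) : ℂ)) (𝓝[>] 0) (𝓝 0) := by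
    intro a ha
    have h1 : Tendsto (fun t : ℝ => t ^ a) (𝓝 0) (𝓝 0) := by
      simpa [Real.zero_rpow ha.ne'] using (Real.continuousAt_rpow_const 0 a (Or.inr ha.le)).tendsto
    simpa [Function.comp_def] using
      (continuous_ofReal.tendsto _).comp (h1.mono_left nhdsWithin_le_nhds)
  induction k generalizing a with
  | zero => simpa using hr ha
  | succ k ih =>
    have h1 : Tendsto (fun t : ℝ => ((Real.log t : ℂ) + c) * ((t ^ (a / 2) : ℝ) : ℂ)) (𝓝[>] 0)
        (𝓝 0) := by
      have h2 := (continuous_ofReal.tendsto _).comp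
        (tendsto_log_mul_rpow_nhdsGT_zero (half_pos ha))
      have := h2.add ((hr (half_pos ha)).const_mul c)
      simp only [ofReal_zero, mul_zero, add_zero] at this
      refine this.congr fun t => ?_
      simp only [Function.comp_apply]
      push_cast
      ring
    have := (ih (half_pos ha)).mul h1
    rw [mul_zero] at this
    refine this.congr' ?_
    filter_upwards [self_mem_nhdsWithin] with t ht
    rw [show ((t ^ a : ℝ) : ℂ) = ((t ^ (a / 2) : ℝ) : ℂ) * ((t ^ (a / 2) : ℝ) : ℂ) by
      rw [← ofReal_mul, ← Real.rpow_add ht, add_halves]]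
    ring

/-- The concomitants of the periods `ω₀, …, ω₃`. -/
def periodPairing : Matrix (Fin 4) (Fin 4) ℂ :=
  !![0, 0, 0, 6; 0, 0, -2, 0; 0, 2, 0, 0; -6, 0, 0, 0]

lemma ofReal_mul_mem_baseDomain {z : ℂ} (hz : z ∈ slitPlane) {t : ℝ} (h0 : 0 < t)
    (ht : t < (5 ^ 5)⁻¹ / ‖z‖) : (t : ℂ) * z ∈ baseDomain := by
  have hpos : 0 < ‖z‖ := norm_pos_iff.2 (slitPlane_ne_zero hz)
  refine ⟨?_, ?_⟩
  · rw [mem_slitPlane_iff] at hz ⊢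
    simp only [mul_re, ofReal_re, ofReal_im, zero_mul, sub_zero, mul_im, add_zero]
    rcases hz with h | h
    · exact Or.inl (by positivity)
    · exact Or.inr (mul_ne_zero h0.ne' h)
  · rw [norm_mul, Complex.norm_of_nonneg h0.le]
    exact (lt_div_iff₀ hpos).1 ht

/-- The value of the concomitant is its limit along a ray through `0`. -/
lemma concForm_periodDeriv (i j : Fin 4) {z : ℂ} (hz : z ∈ baseDomain) :
    concForm z (fun p => periodDeriv i p z) (fun p => periodDeriv j p z) = periodPairing i j := by
  have hz0 := slitPlane_ne_zero hz.1
  have hpos : 0 < ‖z‖ := norm_pos_iff.2 hz0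
  set T : ℝ := (5 ^ 5)⁻¹ / ‖z‖
  have hT : 1 < T := (one_lt_div hpos).2 hz.2
  set f : ℂ → ℂ := fun w => concForm w (fun p => periodDeriv i p w) (fun p => periodDeriv j p w)
  have hf : ∀ t ∈ Set.Ioo (0 : ℝ) T, HasDerivAt (fun s : ℝ => f (s * z)) 0 t := fun t ht => by
    have hb := ofReal_mul_mem_baseDomain hz.1 ht.1 ht.2
    have h1 : HasDerivAt f 0 ((t : ℂ) * z) := hasDerivAt_concForm (slitPlane_ne_zero hb.1)
      (fun p _ => hasDerivAt_periodDeriv i p hb) (fun p _ => hasDerivAt_periodDeriv j p hb)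
      (periodDeriv_picardFuchs i.2 hb) (periodDeriv_picardFuchs j.2 hb)
    have h2 : HasDerivAt (fun s : ℂ => f (s * z)) 0 (t : ℂ) := by
      have := h1.comp (t : ℂ) ((hasDerivAt_id (t : ℂ)).mul_const z)
      rwa [zero_mul] at this
    exact h2.comp_ofReal
  have hconst : ∀ t ∈ Set.Ioo (0 : ℝ) T, f (t * z) = f z := fun t ht => by
    have := isOpen_Ioo.is_const_of_deriv_eq_zero isPreconnected_Ioo
      (fun s hs => (hf s hs).differentiableAt.differentiableWithinAt)
      (fun s hs => (hf s hs).deriv) ht ⟨one_pos, hT⟩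
    simpa using this
  set l : Filter ℝ := 𝓝[>] 0
  set L : ℝ → ℂ := fun t => log (t * z) with hL
  have hlog : ∀ᶠ t in l, L t = (Real.log t : ℂ) + log z := by
    filter_upwards [self_mem_nhdsWithin] with t ht
    exact log_ofReal_mul ht hz0
  have hN : ∀ {a : ℝ}, 0 < a → Negligible l L fun t => ((t ^ a : ℝ) : ℂ) := fun ha k => by
    refine (tendsto_log_pow_mul_rpow (log z) k ha).congr' ?_
    filter_upwards [hlog] with t ht
    rw [ht]
  have hw : Negligible l L fun t => (t : ℂ) * z := by
    have := (moderate_const z) _ (hN one_pos)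
    simpa [mul_comm] using this
  have hsmall : ∀ᶠ t in l, 0 < t ∧ t < T ∧ t * ‖z‖ ≤ 1 / 6250 := by
    have h1 : ∀ᶠ t : ℝ in 𝓝 0, t < T := eventually_lt_nhds (by linarith)
    have h2 : ∀ᶠ t : ℝ in 𝓝 0, t < 1 / 6250 / ‖z‖ := eventually_lt_nhds (by positivity)
    filter_upwards [self_mem_nhdsWithin, nhdsWithin_le_nhds h1, nhdsWithin_le_nhds h2] with t a b c
    exact ⟨a, b, ((lt_div_iff₀ hpos).1 c).le⟩
  have hu : ∀ (i p : ℕ), Negligible l L fun t =>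
      periodDeriv i p (t * z) - i.descFactorial p * L t ^ (i - p) := fun i p k => by
    obtain ⟨C, hC⟩ := exists_norm_periodDeriv_sub_le i p
    have h1 := ((hN (a := 1 / 2) (by norm_num) k).norm).mul_const (C * ‖z‖ ^ (1 / 2 : ℝ))
    rw [norm_zero, zero_mul] at h1
    refine squeeze_zero_norm' ?_ h1
    filter_upwards [hsmall] with t ⟨h0, hT', hs⟩
    have hb := ofReal_mul_mem_baseDomain hz.1 h0 hT'
    have hnorm : ‖(t : ℂ) * z‖ = t * ‖z‖ := by rw [norm_mul, Complex.norm_of_nonneg h0.le]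
    have := hC _ hb.1 (hnorm ▸ hs)
    rw [hnorm, Real.mul_rpow h0.le hpos.le] at this
    rw [norm_mul, norm_mul, Complex.norm_of_nonneg (Real.rpow_nonneg h0.le _), mul_assoc]
    gcongr
    linarith
  have hm : ∀ (i p : ℕ), Moderate l L fun t => (i.descFactorial p : ℂ) * L t ^ (i - p) :=
    fun i p => (moderate_const _).mul (moderate_self.pow _)
  have key := (Negligible.concForm hw (hm i) (hm j) (hu i) (hu j)).tendsto
  have hlim : Tendsto (fun t : ℝ => f z - periodPairing i j) l (𝓝 0) := by
    refine key.congr' ?_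
    filter_upwards [hsmall] with t ⟨h0, hT', _⟩
    rw [← hconst t ⟨h0, hT'⟩]
    congr 1
    fin_cases i <;> fin_cases j <;>
      simp [periodPairing, Nat.descFactorial] <;> ring
  exact sub_eq_zero.1 (tendsto_nhds_unique tendsto_const_nhds hlim)

/-! ### Analytic continuation of the relations -/

lemma isOpen_baseDomain : IsOpen baseDomain :=
  isOpen_slitPlane.inter (isOpen_lt continuous_norm continuous_const)

lemma baseDomain_subset_Mcpl : baseDomain ⊆ Mcpl := by
  intro z hz
  refine ⟨slitPlane_ne_zero hz.1, fun h => ?_⟩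
  have h1 : z = (5 ^ 5)⁻¹ := by
    field_simp; linear_combination -h
  have := hz.2
  rw [h1] at this
  norm_num at this

lemma jet_eq_of_hasDerivAt {U : Set ℂ} (hU : IsOpen U) {f : ℂ → ℂ} {g : ℕ → ℂ → ℂ}
    (h0 : ∀ z ∈ U, z ≠ 0) (hf : ∀ z ∈ U, f z = g 0 z)
    (hg : ∀ p, ∀ z ∈ U, HasDerivAt (g p) (g (p + 1) z / z) z) (p : ℕ) :
    ∀ z ∈ U, jet f z p = g p z := by
  induction p with
  | zero => exact hf
  | succ p ih =>
    intro z hz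
    have : (fun w => jet f w p) =ᶠ[𝓝 z] g p := by
      filter_upwards [hU.mem_nhds hz] with w hw using ih w hw
    rw [jet_succ, this.deriv_eq, (hg p z hz).deriv, mul_div_cancel₀ _ (h0 z hz)]

/-- The relations satisfied by every function element of `√z, ω_i, τ`. -/
structure IsRegularElement (U : Set ℂ) (d : HolData) : Prop where
  isOpen : IsOpen U
  subset : U ⊆ Mcpl
  sqrtz : AnalyticOnNhd ℂ d.sqrtz U
  ω : ∀ i, AnalyticOnNhd ℂ (d.ω i) U
  τ : AnalyticOnNhd ℂ d.τ U
  sqrtz_sq : ∀ z ∈ U, d.sqrtz z ^ 2 = z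
  pf_ω : ∀ i, ∀ z ∈ U, pfForm z (jet (d.ω i) z) = 0
  pf_τ : ∀ z ∈ U, pfForm z (jet d.τ z) = 1 / 16 * d.sqrtz z
  conc : ∀ i j, ∀ z ∈ U, concForm z (jet (d.ω i) z) (jet (d.ω j) z) = periodPairing i j

lemma isRegularElement_base : IsRegularElement baseDomain baseData := by
  have h0 : ∀ z ∈ baseDomain, z ≠ 0 := fun z hz => slitPlane_ne_zero hz.1
  have hω := fun i : Fin 4 => jet_eq_of_hasDerivAt isOpen_baseDomain h0
    (f := baseData.ω i) (g := periodDeriv i) (fun z _ => omega_eq i z)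
    (fun p z hz => hasDerivAt_periodDeriv i p hz)
  have hτ := jet_eq_of_hasDerivAt isOpen_baseDomain h0
    (f := baseData.τ) (g := fun p => frobSum p (1 / 2)) (fun z _ => tau_eq z)
    (fun p z hz => hasDerivAt_frobSum p half_mem_rhoDomain hz)
  refine ⟨isOpen_baseDomain, baseDomain_subset_Mcpl, ?_, fun i => ?_, ?_, fun z hz => ?_,
    fun i z hz => ?_, fun z hz => ?_, fun i j z hz => ?_⟩
  · refine DifferentiableOn.analyticOnNhd (fun z hz => ?_) isOpen_baseDomain
    exact (differentiableAt_id.cpow_const hz.1).differentiableWithinAt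
  · refine DifferentiableOn.analyticOnNhd (fun z hz => ?_) isOpen_baseDomain
    rw [show baseData.ω i = periodDeriv i 0 from funext (omega_eq i)]
    exact (hasDerivAt_periodDeriv i 0 hz).differentiableAt.differentiableWithinAt
  · refine DifferentiableOn.analyticOnNhd (fun z hz => ?_) isOpen_baseDomain
    rw [show baseData.τ = frobSum 0 (1 / 2) from funext tau_eq]
    exact (hasDerivAt_frobSum 0 half_mem_rhoDomain hz).differentiableAt.differentiableWithinAt
  · simp [baseData, ← cpow_nat_mul]
  · rw [show jet (baseData.ω i) z = fun p => periodDeriv i p z from funext fun p => hω i p z hz]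
    exact periodDeriv_picardFuchs i.2 hz
  · rw [show jet baseData.τ z = fun p => frobSum p (1 / 2) z from funext fun p => hτ p z hz]
    simp only [pfForm, baseData]
    linear_combination frobSum_picardFuchs half_mem_rhoDomain hz
  · rw [show jet (baseData.ω i) z = fun p => periodDeriv i p z from funext fun p => hω i p z hz,
      show jet (baseData.ω j) z = fun p => periodDeriv j p z from funext fun p => hω j p z hz]
    exact concForm_periodDeriv i j hz

lemma analyticOnNhd_pfForm {f : ℂ → ℂ} {U : Set ℂ} (h : AnalyticOnNhd ℂ f U) :
    AnalyticOnNhd ℂ (fun z => pfForm z (jet f z)) U := fun z hz => by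
  have h1 := fun p => analyticOnNhd_jet h p z hz
  have := h1 0; have := h1 1; have := h1 2; have := h1 3; have := h1 4
  unfold pfForm
  fun_prop

lemma analyticOnNhd_concForm {f g : ℂ → ℂ} {U : Set ℂ} (hf : AnalyticOnNhd ℂ f U)
    (hg : AnalyticOnNhd ℂ g U) : AnalyticOnNhd ℂ (fun z => concForm z (jet f z) (jet g z)) U :=
  fun z hz => by
  have h1 := fun p => analyticOnNhd_jet hf p z hz
  have h2 := fun p => analyticOnNhd_jet hg p z hz
  have := h1 0; have := h1 1; have := h1 2; have := h1 3
  have := h2 0; have := h2 1; have := h2 2; have := h2 3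
  unfold concForm
  fun_prop

/-- The relations persist under analytic continuation. -/
lemma IsContinuation.isRegularElement {U : Set ℂ} {d : HolData} (h : IsContinuation U d) :
    IsRegularElement U d := by
  induction h with
  | base => exact isRegularElement_base
  | @step U U' d d' _ hopen hconn hsub hs hω hτ z₀ hz hz' es eω eτ ih =>
    have hU := ih.isOpen.mem_nhds hz
    have jω : ∀ i, ∀ᶠ z in 𝓝 z₀, jet (d'.ω i) z = jet (d.ω i) z := fun i => by
      filter_upwards [(eω i).eventually_nhds] with z h
      exact funext fun p => ((jet_congr h p).eq_of_nhds).symm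
    have jτ : ∀ᶠ z in 𝓝 z₀, jet d'.τ z = jet d.τ z := by
      filter_upwards [eτ.eventually_nhds] with z h
      exact funext fun p => ((jet_congr h p).eq_of_nhds).symm
    refine ⟨hopen, hsub, hs, hω, hτ, ?_, fun i => ?_, ?_, fun i j => ?_⟩
    · refine AnalyticOnNhd.eqOn_of_preconnected_of_eventuallyEq (f := fun z => d'.sqrtz z ^ 2)
        (g := fun z => z) (hs.pow 2) analyticOnNhd_id hconn.isPreconnected hz' ?_
      filter_upwards [es, hU] with z h1 h2
      rw [← h1, ih.sqrtz_sq z h2]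
    · refine AnalyticOnNhd.eqOn_of_preconnected_of_eventuallyEq
        (f := fun z => pfForm z (jet (d'.ω i) z)) (g := fun _ => 0) (analyticOnNhd_pfForm (hω i))
        analyticOnNhd_const hconn.isPreconnected hz' ?_
      filter_upwards [jω i, hU] with z h1 h2
      rw [h1, ih.pf_ω i z h2]
    · refine AnalyticOnNhd.eqOn_of_preconnected_of_eventuallyEq
        (f := fun z => pfForm z (jet d'.τ z)) (g := fun z => 1 / 16 * d'.sqrtz z)
        (analyticOnNhd_pfForm hτ) (analyticOnNhd_const.mul hs) hconn.isPreconnected hz' ?_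
      filter_upwards [jτ, es, hU] with z h1 h2 h3
      rw [h1, ih.pf_τ z h3, h2]
    · refine AnalyticOnNhd.eqOn_of_preconnected_of_eventuallyEq
        (f := fun z => concForm z (jet (d'.ω i) z) (jet (d'.ω j) z))
        (g := fun _ => periodPairing i j) (analyticOnNhd_concForm (hω i) (hω j))
        analyticOnNhd_const hconn.isPreconnected hz' ?_
      filter_upwards [jω i, jω j, hU] with z h1 h2 h3
      rw [h1, h2, ih.conc i j z h3]

/-- The first Riemann bilinear relation for the periods: `Ω` and `z ∂_z Ω` are orthogonal for the
symplectic form. -/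
lemma IsRegularElement.riemann_relation {U : Set ℂ} {d : HolData} (h : IsRegularElement U d) {z : ℂ}
    (hz : z ∈ U) : jet (d.ω 0) z 0 * jet (d.ω 3) z 1 - jet (d.ω 0) z 1 * jet (d.ω 3) z 0
      = 3 * (jet (d.ω 1) z 0 * jet (d.ω 2) z 1 - jet (d.ω 1) z 1 * jet (d.ω 2) z 0) := by
  have hp : (1 - 3125 * z) ≠ 0 := by
    have := (h.subset hz).2
    norm_num at this
    exact this
  refine minor_eq_of_concForm (U := Matrix.of fun p i : Fin 4 => jet (d.ω i) z p) hp
    (α := -3125 * z) (β := -1250 * z) ?_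
  ext i j
  rw [← periodPairing, ← h.conc i j z hz]
  simp [Matrix.mul_apply, Fin.sum_univ_four, concForm]
  ring

/-! ### Wirtinger calculus -/

/-- `f` is real differentiable at `z`, with `∂_z f = a` and `∂_{z̄} f = b`. -/
def HasWirtinger (f : ℂ → ℂ) (a b z : ℂ) : Prop :=
  HasFDerivAt f (a • ContinuousLinearMap.id ℝ ℂ + b • (conjCLE : ℂ →L[ℝ] ℂ)) z

/-- `f` is real differentiable at `z`, with `∂_z f = a`. -/
def HasDz (f : ℂ → ℂ) (a z : ℂ) : Prop := ∃ b, HasWirtinger f a b z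

section Wirtinger

variable {f g : ℂ → ℂ} {a b a' b' c z : ℂ}

lemma HasWirtinger.hasDz (h : HasWirtinger f a b z) : HasDz f a z := ⟨b, h⟩

lemma HasWirtinger.dz (h : HasWirtinger f a b z) : dz f z = a := by
  rw [OpenBModel.dz, HasFDerivAt.fderiv h]
  simp
  linear_combination (b / 2 - a / 2) * I_sq

lemma HasWirtinger.dzbar (h : HasWirtinger f a b z) : dzbar f z = b := by
  rw [OpenBModel.dzbar, HasFDerivAt.fderiv h]
  simp
  linear_combination (a / 2 - b / 2) * I_sq

lemma HasDz.dz (h : HasDz f a z) : dz f z = a := h.elim fun _ h => h.dz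

lemma HasDz.differentiableAt (h : HasDz f a z) : DifferentiableAt ℝ f z :=
  h.elim fun _ h => HasFDerivAt.differentiableAt h

lemma HasWirtinger.congr_values (h : HasWirtinger f a b z) (ha : a = a') (hb : b = b') :
    HasWirtinger f a' b' z := ha ▸ hb ▸ h

lemma HasDz.congr_value (h : HasDz f a z) (ha : a = a') : HasDz f a' z := ha ▸ h

lemma HasWirtinger.congr (h : HasWirtinger f a b z) (e : g =ᶠ[𝓝 z] f) : HasWirtinger g a b z :=
  HasFDerivAt.congr_of_eventuallyEq h e

lemma HasDz.congr (h : HasDz f a z) (e : g =ᶠ[𝓝 z] f) : HasDz g a z := h.imp fun _ h => h.congr e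

lemma HasWirtinger.add (hf : HasWirtinger f a b z) (hg : HasWirtinger g a' b' z) :
    HasWirtinger (fun w => f w + g w) (a + a') (b + b') z := by
  refine (HasFDerivAt.add hf hg).congr_fderiv ?_
  ext v
  simp
  ring

lemma HasWirtinger.mul (hf : HasWirtinger f a b z) (hg : HasWirtinger g a' b' z) :
    HasWirtinger (fun w => f w * g w) (a * g z + f z * a') (b * g z + f z * b') z := by
  refine (HasFDerivAt.mul hf hg).congr_fderiv ?_
  ext v
  simp
  ring

lemma hasWirtinger_of_hasDerivAt (h : HasDerivAt f a z) : HasWirtinger f a 0 z := by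
  refine (h.hasFDerivAt.restrictScalars ℝ).congr_fderiv ?_
  ext v
  simp [mul_comm]

lemma HasWirtinger.comp {F : ℂ → ℂ} (hF : HasDerivAt F c (f z)) (h : HasWirtinger f a b z) :
    HasWirtinger (fun w => F (f w)) (c * a) (c * b) z := by
  refine ((hF.hasFDerivAt.restrictScalars ℝ).comp z h).congr_fderiv ?_
  ext v
  simp
  ring

lemma HasWirtinger.conj (h : HasWirtinger f a b z) :
    HasWirtinger (fun w => starRingEnd ℂ (f w)) (starRingEnd ℂ b) (starRingEnd ℂ a) z := by
  refine (((conjCLE : ℂ →L[ℝ] ℂ).hasFDerivAt).comp z h).congr_fderiv ?_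
  ext v
  simp [add_comm]

lemma hasDz_of_hasDerivAt (h : HasDerivAt f a z) : HasDz f a z :=
  (hasWirtinger_of_hasDerivAt h).hasDz

lemma hasDz_const (c z : ℂ) : HasDz (fun _ => c) 0 z := hasDz_of_hasDerivAt (hasDerivAt_const z c)

lemma HasDz.add (hf : HasDz f a z) (hg : HasDz g a' z) : HasDz (fun w => f w + g w) (a + a') z :=
  let ⟨_, h⟩ := hf; let ⟨_, h'⟩ := hg; (h.add h').hasDz

lemma HasDz.mul (hf : HasDz f a z) (hg : HasDz g a' z) :
    HasDz (fun w => f w * g w) (a * g z + f z * a') z :=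
  let ⟨_, h⟩ := hf; let ⟨_, h'⟩ := hg; (h.mul h').hasDz

lemma HasDz.const_mul (hf : HasDz f a z) (c : ℂ) : HasDz (fun w => c * f w) (c * a) z := by
  simpa using (hasDz_const c z).mul hf

lemma HasDz.neg (hf : HasDz f a z) : HasDz (fun w => -f w) (-a) z := by
  simpa using hf.const_mul (-1)

lemma HasDz.sub (hf : HasDz f a z) (hg : HasDz g a' z) : HasDz (fun w => f w - g w) (a - a') z := by
  simpa only [sub_eq_add_neg] using hf.add hg.neg

lemma HasDz.comp {F : ℂ → ℂ} (hF : HasDerivAt F c (f z)) (h : HasDz f a z) :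
    HasDz (fun w => F (f w)) (c * a) z := let ⟨_, h⟩ := h; (HasWirtinger.comp hF h).hasDz

lemma HasDz.div (hf : HasDz f a z) (hg : HasDz g a' z) (h0 : g z ≠ 0) :
    HasDz (fun w => f w / g w) ((a * g z - f z * a') / g z ^ 2) z := by
  have := hf.mul (HasDz.comp (hasDerivAt_inv h0) hg)
  simp only [← div_eq_mul_inv] at this
  refine this.congr_value ?_
  field_simp
  ring

lemma HasDz.pow (hf : HasDz f a z) (n : ℕ) : HasDz (fun w => f w ^ n) (n * f z ^ (n - 1) * a) z :=
  HasDz.comp (hasDerivAt_pow n (f z)) hf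

end Wirtinger

/-! ### Special geometry -/

/-- The covector `⟨·, v⟩` for the Hermitian form `(Ω, Ω̄)`, in terms of the conjugate
periods `v`. -/
noncomputable def dualCovector (v : Fin 4 → ℂ) : Fin 4 → ℂ :=
  ![400 * (riemannZeta 3).re * v 0 - 5 / 6 * v 3, -(5 / 2) * v 2, -(5 / 2) * v 1, -(5 / 6) * v 0]

lemma pfForm_sum (z : ℂ) (c : Fin 4 → ℂ) (u : Fin 4 → ℕ → ℂ) :
    pfForm z (fun p => ∑ i, c i * u i p) = ∑ i, c i * pfForm z (u i) := by
  simp only [pfForm, Fin.sum_univ_four]; ring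

lemma concForm_sum (z : ℂ) (c d : Fin 4 → ℂ) (u : Fin 4 → ℕ → ℂ) :
    concForm z (fun p => ∑ i, c i * u i p) (fun p => ∑ i, d i * u i p)
      = ∑ i, ∑ j, c i * d j * concForm z (u i) (u j) := by
  simp only [concForm, Fin.sum_univ_four]; ring

lemma HasWirtinger.sum_four {f : Fin 4 → ℂ → ℂ} {a b : Fin 4 → ℂ} {z : ℂ}
    (h : ∀ i, HasWirtinger (f i) (a i) (b i) z) :
    HasWirtinger (fun w => ∑ i, f i w) (∑ i, a i) (∑ i, b i) z := by
  simp only [Fin.sum_univ_four]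
  exact (((h 0).add (h 1)).add (h 2)).add (h 3)

lemma hasWirtinger_dualCovector {v : Fin 4 → ℂ → ℂ} {v' : Fin 4 → ℂ} {z : ℂ}
    (h : ∀ i, HasWirtinger (v i) 0 (v' i) z) (i : Fin 4) :
    HasWirtinger (fun w => dualCovector (fun j => v j w) i) 0 (dualCovector v' i) z := by
  have hc : ∀ (c : ℂ) (j : Fin 4), HasWirtinger (fun w => c * v j w) 0 (c * v' j) z := fun c j =>
    ((hasWirtinger_of_hasDerivAt (hasDerivAt_const z c)).mul (h j)).congr_values (by simp) (by simp)
  fin_cases i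
  · refine ((hc (400 * (riemannZeta 3).re) 0).add (hc (-(5 / 6)) 3)).congr ?_ |>.congr_values
      (by simp) ?_
    · exact Eventually.of_forall fun w => by simp [dualCovector]; ring
    · simp [dualCovector]; ring
  · exact hc _ 2
  · exact hc _ 1
  · exact hc _ 0

namespace Branch

variable (b : Branch)

lemma regular : IsRegularElement b.U b.toHolData := b.isContinuation.isRegularElement

/-- `θ^p` applied to the first factor of `(Ω, Ω̄)`. -/
noncomputable def X (p : ℕ) (z : ℂ) : ℂ :=
  ∑ i, dualCovector (fun i => starRingEnd ℂ (b.ω i z)) i * jet (b.ω i) z p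

/-- `θ^p` applied to the first factor of `(Ω, ∂_{z̄} Ω̄)`. -/
noncomputable def Y (p : ℕ) (z : ℂ) : ℂ :=
  ∑ i, dualCovector (fun i => starRingEnd ℂ (deriv (b.ω i) z)) i * jet (b.ω i) z p

/-- The `2 × 2` minors of the pair of jets `X, Y`. -/
noncomputable def minor (p q : ℕ) (z : ℂ) : ℂ := b.X p z * b.Y q z - b.X q z * b.Y p z

variable {b} {z : ℂ}

lemma ne_zero_of_mem (hz : z ∈ b.U) : z ≠ 0 := (b.regular.subset hz).1

lemma disc_ne_zero (hz : z ∈ b.U) : 1 - 3125 * z ≠ 0 := by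
  have := (b.regular.subset hz).2
  norm_num at this
  exact this

lemma ofReal_expNegK (z : ℂ) : (b.expNegK z : ℂ) = b.X 0 z := by
  have hre : ∀ u : ℂ, (u.re : ℂ) = (u + starRingEnd ℂ u) / 2 := re_eq_add_conj
  have hn : ((‖b.ω 0 z‖ : ℂ)) ^ 2 = b.ω 0 z * starRingEnd ℂ (b.ω 0 z) := (mul_conj' _).symm
  simp only [expNegK, X, dualCovector, Fin.sum_univ_four]
  push_cast
  rw [hn]
  simp only [hre, map_mul, conj_conj]
  simp
  ring

lemma hasWirtinger_X (hz : z ∈ b.U) (p : ℕ) :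
    HasWirtinger (b.X p) (b.X (p + 1) z / z) (b.Y p z) z := by
  have hv : ∀ i, HasWirtinger (fun w => starRingEnd ℂ (b.ω i w)) 0
      (starRingEnd ℂ (deriv (b.ω i) z)) z := fun i =>
    (hasWirtinger_of_hasDerivAt (b.regular.ω i z hz).differentiableAt.hasDerivAt).conj.congr_values
      (by simp) rfl
  have := HasWirtinger.sum_four fun i => (hasWirtinger_dualCovector hv i).mul
    (hasWirtinger_of_hasDerivAt (hasDerivAt_jet (b.regular.ω i z hz) (ne_zero_of_mem hz) p))
  refine this.congr_values ?_ ?_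
  · simp only [X, Finset.sum_div]
    exact Finset.sum_congr rfl fun i _ => by ring
  · simp only [Y]
    exact Finset.sum_congr rfl fun i _ => by ring

lemma hasDz_X (hz : z ∈ b.U) (p : ℕ) : HasDz (b.X p) (b.X (p + 1) z / z) z :=
  (hasWirtinger_X hz p).hasDz

lemma hasDz_Y (hz : z ∈ b.U) (p : ℕ) : HasDz (b.Y p) (b.Y (p + 1) z / z) z := by
  have hv : ∀ i, HasWirtinger (fun w => starRingEnd ℂ (deriv (b.ω i) w)) 0
      (starRingEnd ℂ (deriv (deriv (b.ω i)) z)) z := fun i =>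
    (hasWirtinger_of_hasDerivAt
      ((b.regular.ω i).deriv z hz).differentiableAt.hasDerivAt).conj.congr_values (by simp) rfl
  have := HasWirtinger.sum_four fun i => (hasWirtinger_dualCovector hv i).mul
    (hasWirtinger_of_hasDerivAt (hasDerivAt_jet (b.regular.ω i z hz) (ne_zero_of_mem hz) p))
  refine (this.congr_values ?_ rfl).hasDz
  simp only [Y, Finset.sum_div]
  exact Finset.sum_congr rfl fun i _ => by ring

lemma pfForm_X (hz : z ∈ b.U) : pfForm z (fun p => b.X p z) = 0 := by
  simp only [X]
  rw [pfForm_sum z (dualCovector fun i => starRingEnd ℂ (b.ω i z)) fun i => jet (b.ω i) z]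
  exact Finset.sum_eq_zero fun i _ => by rw [b.regular.pf_ω i z hz, mul_zero]

/-- The plane spanned by `(·, Ω̄)` and `(·, ∂_{z̄} Ω̄)` is isotropic for the concomitant. -/
lemma concForm_X_Y (hz : z ∈ b.U) : concForm z (fun p => b.X p z) (fun p => b.Y p z) = 0 := by
  simp only [X, Y]
  rw [concForm_sum z (dualCovector fun i => starRingEnd ℂ (b.ω i z))
    (dualCovector fun i => starRingEnd ℂ (deriv (b.ω i) z)) fun i => jet (b.ω i) z]
  have h := b.regular.riemann_relation hz
  simp only [jet_succ, jet_zero] at h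
  have h' : b.ω 0 z * deriv (b.ω 3) z - deriv (b.ω 0) z * b.ω 3 z
      = 3 * (b.ω 1 z * deriv (b.ω 2) z - deriv (b.ω 1) z * b.ω 2 z) :=
    mul_left_cancel₀ (ne_zero_of_mem hz) (by linear_combination h)
  have h2 := congrArg (starRingEnd ℂ) h'
  simp only [map_sub, map_mul, map_ofNat] at h2
  simp only [b.regular.conc _ _ z hz]
  simp [Fin.sum_univ_four, periodPairing, dualCovector]
  linear_combination -(25 / 6) * h2

lemma minor_relation (hz : z ∈ b.U) : (1 - 3125 * z) * (b.minor 0 3 z - b.minor 1 2 z)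
    = 3125 * z * b.minor 0 2 z + 1250 * z * b.minor 0 1 z := by
  have := concForm_X_Y hz
  simp only [concForm] at this
  simp only [minor]
  linear_combination this

lemma pluecker : b.X 0 z * b.minor 1 2 z = b.X 1 z * b.minor 0 2 z - b.X 2 z * b.minor 0 1 z := by
  simp only [minor]; ring

variable (b) in
/-- The points of the branch at which `K` is defined. -/
def posSet : Set ℂ := {z | z ∈ b.U ∧ 0 < b.expNegK z}

lemma expNegK_eq_re (z : ℂ) : b.expNegK z = (b.X 0 z).re := by rw [← ofReal_expNegK, ofReal_re]

lemma isOpen_posSet : IsOpen b.posSet := by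
  have h : ContinuousOn (fun z => (b.X 0 z).re) b.U := fun z hz =>
    (continuous_re.continuousAt.comp
      (hasDz_X hz 0).differentiableAt.continuousAt).continuousWithinAt
  have := h.isOpen_inter_preimage b.regular.isOpen (isOpen_Ioi (a := 0))
  convert this using 1
  ext z
  simp [posSet, expNegK_eq_re]

lemma X_zero_ne_zero (hz : z ∈ b.posSet) : b.X 0 z ≠ 0 := by
  rw [← ofReal_expNegK, ofReal_ne_zero]
  exact hz.2.ne'

lemma hasWirtinger_Kc (hz : z ∈ b.posSet) :
    HasWirtinger b.Kc (-(b.X 1 z / (z * b.X 0 z))) (-(b.Y 0 z / b.X 0 z)) z := by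
  have hx := X_zero_ne_zero hz
  have hslit : b.X 0 z ∈ slitPlane := by
    rw [← ofReal_expNegK]; exact ofReal_mem_slitPlane.2 hz.2
  have h1 := HasWirtinger.comp (hasDerivAt_log hslit).neg (hasWirtinger_X hz.1 0)
  have e : b.Kc =ᶠ[𝓝 z] fun w => -log (b.X 0 w) := by
    filter_upwards [isOpen_posSet.mem_nhds hz] with w hw
    rw [← ofReal_expNegK, ← ofReal_log hw.2.le, Kc, K, ofReal_neg]
  refine (h1.congr e).congr_values ?_ ?_
  · have := ne_zero_of_mem hz.1
    field_simp
  · ring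

lemma dz_Kc_of_posSet (hz : z ∈ b.posSet) : dz b.Kc z = -(b.X 1 z / (z * b.X 0 z)) :=
  (hasWirtinger_Kc hz).dz

lemma dzbar_Kc (hz : z ∈ b.posSet) : dzbar b.Kc z = -(b.Y 0 z / b.X 0 z) :=
  (hasWirtinger_Kc hz).dzbar

lemma hasDz_dzbar_Kc (hz : z ∈ b.posSet) :
    HasDz (dzbar b.Kc) (-(b.minor 0 1 z / (z * b.X 0 z ^ 2))) z := by
  have hx := X_zero_ne_zero hz
  have hz0 := ne_zero_of_mem hz.1
  refine (((hasDz_Y hz.1 0).div (hasDz_X hz.1 0) hx).neg.congr ?_).congr_value ?_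
  · filter_upwards [isOpen_posSet.mem_nhds hz] with w hw using dzbar_Kc hw
  · simp only [minor, zero_add]
    field_simp

lemma G_eq (hz : z ∈ b.posSet) : b.G z = -(b.minor 0 1 z / (z * b.X 0 z ^ 2)) :=
  (hasDz_dzbar_Kc hz).dz

lemma hasDz_minor_zero_one (hz : z ∈ b.U) : HasDz (b.minor 0 1) (b.minor 0 2 z / z) z := by
  refine (((hasDz_X hz 0).mul (hasDz_Y hz 1)).sub ((hasDz_X hz 1).mul
    (hasDz_Y hz 0))).congr_value ?_
  simp only [minor]
  ring

lemma hasDz_minor_zero_two (hz : z ∈ b.U) :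
    HasDz (b.minor 0 2) ((b.minor 1 2 z + b.minor 0 3 z) / z) z := by
  refine (((hasDz_X hz 0).mul (hasDz_Y hz 2)).sub ((hasDz_X hz 2).mul
    (hasDz_Y hz 0))).congr_value ?_
  simp only [minor]
  ring

lemma hasDz_G_of_posSet (hz : z ∈ b.posSet) : HasDz b.G (-(b.minor 0 2 z / (z ^ 2 * b.X 0 z ^ 2))
    + b.minor 0 1 z * (b.X 0 z + 2 * b.X 1 z) / (z ^ 2 * b.X 0 z ^ 3)) z := by
  have hx := X_zero_ne_zero hz
  have hz0 := ne_zero_of_mem hz.1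
  have h := ((hasDz_minor_zero_one hz.1).div
    ((hasDz_of_hasDerivAt (hasDerivAt_id z)).mul ((hasDz_X hz.1 0).pow 2))
    (mul_ne_zero hz0 (pow_ne_zero 2 hx))).neg
  refine (h.congr ?_).congr_value ?_
  · filter_upwards [isOpen_posSet.mem_nhds hz] with w hw using G_eq hw
  · simp only [id, zero_add]
    push_cast
    field_simp
    ring

lemma isOpen_dom : IsOpen b.dom := by
  have h : ContinuousOn (fun z => (b.G z).re) b.posSet := fun z hz =>
    (continuous_re.continuousAt.comp
      (hasDz_G_of_posSet hz).differentiableAt.continuousAt).continuousWithinAt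
  have := h.isOpen_inter_preimage isOpen_posSet (isOpen_Ioi (a := 0))
  convert this using 1
  ext z
  exact ⟨fun h => ⟨⟨h.1, h.2.1⟩, h.2.2⟩, fun h => ⟨h.1.1, h.1.2, h.2⟩⟩

lemma mem_posSet (hz : z ∈ b.dom) : z ∈ b.posSet := ⟨hz.1, hz.2.1⟩

lemma G_ne_zero (hz : z ∈ b.dom) : b.G z ≠ 0 := fun h => by
  have := hz.2.2
  simp [h] at this

lemma minor_ne_zero (hz : z ∈ b.dom) : b.minor 0 1 z ≠ 0 := fun h => by
  apply G_ne_zero hz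
  rw [G_eq (mem_posSet hz), h]
  simp

/-! ### Derivatives of the generators -/

lemma iterate_theta_eq {U : Set ℂ} (hU : IsOpen U) {f : ℂ → ℂ} {g : ℕ → ℂ → ℂ}
    (h0 : ∀ z ∈ U, z ≠ 0) (hf : ∀ z ∈ U, f z = g 0 z)
    (hg : ∀ p, ∀ z ∈ U, HasDz (g p) (g (p + 1) z / z) z) (p : ℕ) :
    ∀ z ∈ U, (θ^[p] f) z = g p z := by
  induction p with
  | zero => exact hf
  | succ p ih =>
    intro z hz
    have h1 : HasDz (θ^[p] f) (g (p + 1) z / z) z := (hg p z hz).congr <| by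
      filter_upwards [hU.mem_nhds hz] with w hw using ih w hw
    rw [Function.iterate_succ_apply', θ, h1.dz, mul_div_cancel₀ _ (h0 z hz)]

lemma B_eq (hz : z ∈ b.U) (p : ℕ) : b.B p z = b.X p z / b.X 0 z := by
  rw [B, iterate_theta_eq b.regular.isOpen (fun _ => ne_zero_of_mem) (g := b.X)
    (fun z _ => ofReal_expNegK z) (fun p z hz => hasDz_X hz p) p z hz, ofReal_expNegK]

lemma hasDz_B (hz : z ∈ b.dom) (p : ℕ) :
    HasDz (b.B p) ((b.B (p + 1) z - b.B 1 z * b.B p z) / z) z := by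
  have hx := X_zero_ne_zero (mem_posSet hz)
  have hz0 := ne_zero_of_mem hz.1
  refine (((hasDz_X hz.1 p).div (hasDz_X hz.1 0) hx).congr ?_).congr_value ?_
  · filter_upwards [b.regular.isOpen.mem_nhds hz.1] with w hw using B_eq hw p
  · rw [B_eq hz.1, B_eq hz.1, B_eq hz.1]
    simp only [zero_add]
    field_simp

lemma B_four (hz : z ∈ b.dom) : b.B 4 z = z / (1 - 3125 * z)
    * (6250 * b.B 3 z + 4375 * b.B 2 z + 1250 * b.B 1 z + 120) := by
  have hx := X_zero_ne_zero (mem_posSet hz)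
  have hd := disc_ne_zero hz.1
  have h := pfForm_X hz.1
  simp only [pfForm] at h
  rw [B_eq hz.1, B_eq hz.1, B_eq hz.1, B_eq hz.1, div_mul_eq_mul_div, eq_div_iff hd]
  field_simp
  linear_combination h

lemma dz_Kc (hz : z ∈ b.dom) : dz b.Kc z = -b.B 1 z / z := by
  rw [dz_Kc_of_posSet (mem_posSet hz), B_eq hz.1, neg_div, div_div, mul_comm z]

lemma dz_G (hz : z ∈ b.dom) : dz b.G z = b.G z * b.A 1 z / z := by
  have := G_ne_zero hz
  have := ne_zero_of_mem hz.1
  simp only [A, Function.iterate_one, θ]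
  field_simp

lemma hasDz_G (hz : z ∈ b.dom) : HasDz b.G (b.G z * b.A 1 z / z) z := by
  rw [← dz_G hz, (hasDz_G_of_posSet (mem_posSet hz)).dz]
  exact hasDz_G_of_posSet (mem_posSet hz)

lemma A_one_eq (hz : z ∈ b.dom) :
    b.A 1 z = b.minor 0 2 z / b.minor 0 1 z - 1 - 2 * b.B 1 z := by
  have hx := X_zero_ne_zero (mem_posSet hz)
  have hz0 := ne_zero_of_mem hz.1
  have hm := minor_ne_zero hz
  rw [A, Function.iterate_one, θ, (hasDz_G_of_posSet (mem_posSet hz)).dz, G_eq (mem_posSet hz),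
    B_eq hz.1]
  field_simp
  ring

/-- The right-hand side of the relation expressing `θ A₁` through `A₁, B₁, B₂`. -/
noncomputable def thetaAOne (z A₁ B₁ B₂ : ℂ) : ℂ :=
  2 * (B₁ * (A₁ + 1 + 2 * B₁) - B₂) + z / (1 - 3125 * z) * (3125 * (A₁ + 1 + 2 * B₁) + 1250)
    - (A₁ + 1 + 2 * B₁) ^ 2 - 2 * (B₂ - B₁ ^ 2)

/-- The special geometry relation: it follows from the vanishing of the concomitant of
`(·, Ω̄)` and `(·, ∂_{z̄} Ω̄)` and a Plücker relation. -/
lemma hasDz_A_one (hz : z ∈ b.dom) :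
    HasDz (b.A 1) (thetaAOne z (b.A 1 z) (b.B 1 z) (b.B 2 z) / z) z := by
  have hx := X_zero_ne_zero (mem_posSet hz)
  have hz0 := ne_zero_of_mem hz.1
  have hm := minor_ne_zero hz
  have hd := disc_ne_zero hz.1
  have h := (((hasDz_minor_zero_two hz.1).div (hasDz_minor_zero_one hz.1) hm).sub
    (hasDz_const 1 z)).sub ((hasDz_B hz 1).const_mul 2)
  refine (h.congr ?_).congr_value ?_
  · filter_upwards [isOpen_dom.mem_nhds hz] with w hw using A_one_eq hw
  · have e1 : b.minor 1 2 z = b.B 1 z * b.minor 0 2 z - b.B 2 z * b.minor 0 1 z := by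
      rw [B_eq hz.1, B_eq hz.1]
      field_simp
      linear_combination pluecker
    have e2 : b.minor 0 3 z = b.minor 1 2 z
        + z / (1 - 3125 * z) * (3125 * b.minor 0 2 z + 1250 * b.minor 0 1 z) := by
      rw [div_mul_eq_mul_div, ← sub_eq_iff_eq_add', eq_div_iff hd]
      linear_combination minor_relation hz.1
    rw [A_one_eq hz, e2, e1, thetaAOne]
    field_simp
    ring

lemma sqrtz_sq (hz : z ∈ b.U) : b.sqrtz z ^ 2 = z := b.regular.sqrtz_sq z hz

lemma sqrtz_ne_zero (hz : z ∈ b.U) : b.sqrtz z ≠ 0 := fun h => by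
  have := sqrtz_sq hz
  rw [h] at this
  exact ne_zero_of_mem hz (by simpa using this.symm)

lemma hasDz_sqrtz (hz : z ∈ b.U) : HasDz b.sqrtz (b.sqrtz z / (2 * z)) z := by
  have h := (b.regular.sqrtz z hz).differentiableAt.hasDerivAt
  have h2 : HasDerivAt (fun w => b.sqrtz w ^ 2) 1 z := (hasDerivAt_id z).congr_of_eventuallyEq <| by
    filter_upwards [b.regular.isOpen.mem_nhds hz] with w hw using sqrtz_sq hw
  have h3 := (h.pow 2).unique h2
  have hs := sqrtz_ne_zero hz
  refine hasDz_of_hasDerivAt (h.congr_deriv ?_)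
  have hz' := sqrtz_sq hz
  have hz0 := ne_zero_of_mem hz
  rw [eq_div_iff (by simpa using hz0)]
  have h4 : 2 * b.sqrtz z * deriv b.sqrtz z = 1 := by simpa using h3
  linear_combination b.sqrtz z * h4 - 2 * deriv b.sqrtz z * hz'

lemma Q_eq (hz : z ∈ b.U) (p : ℕ) : b.Q p z = b.sqrtz z * (60 * jet b.τ z p) := by
  rw [Q, iterate_theta_eq (f := b.T) b.regular.isOpen (fun _ => ne_zero_of_mem)
    (g := fun p w => 60 * jet b.τ w p) (fun z _ => rfl)
    (fun p z hz => ((hasDz_of_hasDerivAt (hasDerivAt_jet (b.regular.τ z hz) (ne_zero_of_mem hz)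
      p)).const_mul 60).congr_value (by ring)) p z hz]

lemma hasDz_Q (hz : z ∈ b.U) (p : ℕ) : HasDz (b.Q p) ((b.Q p z / 2 + b.Q (p + 1) z) / z) z := by
  have hz0 := ne_zero_of_mem hz
  refine (((hasDz_sqrtz hz).mul ((hasDz_of_hasDerivAt (hasDerivAt_jet (b.regular.τ z hz) hz0
      p)).const_mul 60)).congr ?_).congr_value ?_
  · filter_upwards [b.regular.isOpen.mem_nhds hz] with w hw using Q_eq hw p
  · rw [Q_eq hz, Q_eq hz]
    field_simp

lemma Q_four (hz : z ∈ b.U) : b.Q 4 z = z / (1 - 3125 * z)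
    * (6250 * b.Q 3 z + 4375 * b.Q 2 z + 1250 * b.Q 1 z + 120 * b.Q 0 z + 15 / 4) := by
  have hd := disc_ne_zero hz
  have h := b.regular.pf_τ z hz
  have hs := sqrtz_sq hz
  simp only [pfForm] at h
  rw [Q_eq hz, Q_eq hz, Q_eq hz, Q_eq hz, Q_eq hz, div_mul_eq_mul_div, eq_div_iff hd]
  linear_combination 60 * b.sqrtz z * h + 15 / 4 * hs

lemma expK_eq (hz : z ∈ b.posSet) : b.expK z = (b.X 0 z)⁻¹ := by
  rw [expK, Kc, K, ofReal_neg, exp_neg, ofReal_log hz.2.le, exp_log, ofReal_expNegK]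
  exact ofReal_ne_zero.2 hz.2.ne'

lemma hasDz_Czzz (hz : z ∈ b.U) :
    HasDz Czzz (Czzz z * (3125 / (1 - 3125 * z) - 3 / z)) z := by
  have hz0 := ne_zero_of_mem hz
  have hd := disc_ne_zero hz
  have h1 : HasDerivAt (fun w : ℂ => 1 - 5 ^ 5 * w) (-5 ^ 5) z := by
    simpa using ((hasDerivAt_id z).const_mul (5 ^ 5 : ℂ)).const_sub 1
  have hne : (1 - 5 ^ 5 * z) * z ^ 3 ≠ 0 := mul_ne_zero (by norm_num; exact hd) (pow_ne_zero 3 hz0)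
  have h := (hasDerivAt_const z (5 : ℂ)).div (h1.mul (hasDerivAt_pow 3 z)) hne
  refine hasDz_of_hasDerivAt (h.congr_deriv ?_)
  rw [Czzz]
  simp only [Pi.mul_apply]
  norm_num
  field_simp
  ring

lemma hasWirtinger_conj_T (hz : z ∈ b.U) : HasWirtinger (fun w => starRingEnd ℂ (b.T w)) 0
    (starRingEnd ℂ (60 * deriv b.τ z)) z :=
  (hasWirtinger_of_hasDerivAt
    ((b.regular.τ z hz).differentiableAt.hasDerivAt.const_mul 60)).conj.congr_values (by simp) rfl

/-- `∂_z D̄_{z̄} 𝒯̄ = G_{z z̄} 𝒯̄`. -/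
lemma hasDz_DbarTbar (hz : z ∈ b.dom) :
    HasDz b.DbarTbar (b.G z * starRingEnd ℂ (b.T z)) z := by
  have h1 : HasDz (fun w => starRingEnd ℂ (60 * deriv b.τ w)) 0 z :=
    ((hasWirtinger_of_hasDerivAt
      ((b.regular.τ.deriv z hz.1).differentiableAt.hasDerivAt.const_mul 60)).conj.congr_values
        (by simp) rfl).hasDz
  refine ((h1.add ((hasDz_dzbar_Kc (mem_posSet hz)).mul
    (hasWirtinger_conj_T hz.1).hasDz)).congr ?_).congr_value ?_
  · filter_upwards [b.regular.isOpen.mem_nhds hz.1] with w hw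
    rw [DbarTbar, (hasWirtinger_conj_T hw).dzbar]
  · rw [G_eq (mem_posSet hz)]
    ring

lemma hasDz_expK (hz : z ∈ b.dom) : HasDz b.expK (-b.expK z * b.B 1 z / z) z := by
  have hx := X_zero_ne_zero (mem_posSet hz)
  have hz0 := ne_zero_of_mem hz.1
  refine ((HasDz.comp (hasDerivAt_inv hx) (hasDz_X hz.1 0)).congr ?_).congr_value ?_
  · filter_upwards [isOpen_posSet.mem_nhds (mem_posSet hz)] with w hw using expK_eq hw
  · rw [expK_eq (mem_posSet hz), B_eq hz.1]
    simp only [zero_add]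
    field_simp

lemma hasDz_R₁ (hz : z ∈ b.dom) : HasDz b.R₁ ((b.R₁ z * (3125 * z / (1 - 3125 * z) - 1 / 2
    - b.B 1 z - b.A 1 z) + b.R₂ z) / z) z := by
  have hz0 := ne_zero_of_mem hz.1
  have hG := G_ne_zero hz
  have hd := disc_ne_zero hz.1
  have hs := sqrtz_sq hz.1
  have h := (((hasDz_sqrtz hz.1).pow 5).mul (((hasDz_expK hz).mul (hasDz_Czzz hz.1)).div
    (hasDz_G hz) hG)).mul (hasDz_DbarTbar hz)
  refine h.congr_value ?_
  rw [R₁, R₂]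
  have e : b.sqrtz z ^ 7 = b.sqrtz z ^ 5 * z := by
    linear_combination b.sqrtz z ^ 5 * hs
  rw [e]
  push_cast
  field_simp
  ring

lemma hasDz_R₂ (hz : z ∈ b.dom) : HasDz b.R₂ (b.R₂ z * (3125 * z / (1 - 3125 * z) + 1 / 2
    - b.B 1 z) / z) z := by
  have hz0 := ne_zero_of_mem hz.1
  have hd := disc_ne_zero hz.1
  have h := ((((hasDz_sqrtz hz.1).pow 7).mul (hasDz_expK hz)).mul (hasDz_Czzz hz.1)).mul
    (hasWirtinger_conj_T hz.1).hasDz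
  refine h.congr_value ?_
  rw [R₂]
  push_cast
  field_simp
  ring

end Branch

/-! ### The ring of polynomials in the generators without poles in the moduli space -/

/-- The algebra of polynomials in the generators whose coefficients are rational functions with
poles only at `0`, `5⁻⁵` and `∞`. -/
noncomputable def polyRing : Subalgebra ℂ (Branch → ℂ → ℂ) :=
  Algebra.adjoin ℂ ({(fun _ z => z), (fun _ z => z⁻¹), (fun _ z => (1 - 3125 * z)⁻¹)} ∪
    Set.range fun i b => b.generator i)

/-- `f` agrees with an element of `polyRing` at all points of all branches. In contrast to `MemI`,
there are no exceptional points, so that this notion is stable under products and derivatives. -/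
def IsPoly (f : Branch → ℂ → ℂ) : Prop := ∃ g ∈ polyRing, ∀ b, ∀ z ∈ b.dom, f b z = g b z

namespace IsPoly

variable {f g : Branch → ℂ → ℂ}

lemma congr (hf : IsPoly f) (h : ∀ b, ∀ z ∈ b.dom, g b z = f b z) : IsPoly g :=
  let ⟨p, hp, e⟩ := hf; ⟨p, hp, fun b z hz => (h b z hz).trans (e b z hz)⟩

lemma add (hf : IsPoly f) (hg : IsPoly g) : IsPoly fun b z => f b z + g b z :=
  let ⟨p, hp, e⟩ := hf; let ⟨q, hq, e'⟩ := hg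
  ⟨p + q, add_mem hp hq, fun b z hz => by simp [e b z hz, e' b z hz]⟩

lemma mul (hf : IsPoly f) (hg : IsPoly g) : IsPoly fun b z => f b z * g b z :=
  let ⟨p, hp, e⟩ := hf; let ⟨q, hq, e'⟩ := hg
  ⟨p * q, mul_mem hp hq, fun b z hz => by simp [e b z hz, e' b z hz]⟩

lemma const (c : ℂ) : IsPoly fun _ _ => c :=
  ⟨algebraMap ℂ _ c, polyRing.algebraMap_mem c, fun _ _ _ => rfl⟩

lemma neg (hf : IsPoly f) : IsPoly fun b z => -f b z :=
  ((const (-1)).mul hf).congr fun _ _ _ => by ring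

lemma sub (hf : IsPoly f) (hg : IsPoly g) : IsPoly fun b z => f b z - g b z :=
  (hf.add hg.neg).congr fun _ _ _ => sub_eq_add_neg _ _

lemma pow (hf : IsPoly f) (n : ℕ) : IsPoly fun b z => f b z ^ n := by
  induction n with
  | zero => simpa using const 1
  | succ n ih => simpa only [pow_succ] using ih.mul hf

lemma sum {ι : Type*} (s : Finset ι) {f : ι → Branch → ℂ → ℂ} (h : ∀ i ∈ s, IsPoly (f i)) :
    IsPoly fun b z => ∑ i ∈ s, f i b z := by
  classical
  induction s using Finset.induction_on with
  | empty => simpa using const 0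
  | insert a s ha ih =>
    simp only [Finset.sum_insert ha]
    exact (h a (by simp)).add (ih fun i hi => h i (by simp [hi]))

lemma z : IsPoly fun _ z => z := ⟨_, Algebra.subset_adjoin (by simp), fun _ _ _ => rfl⟩

lemma z_inv : IsPoly fun _ z => z⁻¹ := ⟨_, Algebra.subset_adjoin (by simp), fun _ _ _ => rfl⟩

lemma disc_inv : IsPoly fun _ z => (1 - 3125 * z)⁻¹ :=
  ⟨_, Algebra.subset_adjoin (by simp), fun _ _ _ => rfl⟩

lemma div_z (hf : IsPoly f) : IsPoly fun b z => f b z / z := hf.mul z_inv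

lemma polynomial (p : Polynomial ℂ) : IsPoly fun _ z => p.eval z := by
  induction p using Polynomial.induction_on' with
  | add p q hp hq => simpa using hp.add hq
  | monomial n a => simpa using (const a).mul (z.pow n)

lemma generator (i : Fin 10) : IsPoly fun b => b.generator i :=
  ⟨_, Algebra.subset_adjoin (Or.inr ⟨i, rfl⟩), fun _ _ _ => rfl⟩

lemma A_one : IsPoly fun b => b.A 1 := generator 0
lemma B_one : IsPoly fun b => b.B 1 := generator 1
lemma B_two : IsPoly fun b => b.B 2 := generator 2
lemma B_three : IsPoly fun b => b.B 3 := generator 3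
lemma Q_zero : IsPoly fun b => b.Q 0 := generator 4
lemma Q_one : IsPoly fun b => b.Q 1 := generator 5
lemma Q_two : IsPoly fun b => b.Q 2 := generator 6
lemma Q_three : IsPoly fun b => b.Q 3 := generator 7
lemma R₁ : IsPoly fun b => b.R₁ := generator 8
lemma R₂ : IsPoly fun b => b.R₂ := generator 9

lemma z_mul_disc_inv : IsPoly fun _ z => z / (1 - 3125 * z) := z.mul disc_inv

lemma B_four : IsPoly fun b => b.B 4 :=
  (z_mul_disc_inv.mul (((((const 6250).mul B_three).add ((const 4375).mul B_two)).add
    ((const 1250).mul B_one)).add (const 120))).congr fun _ _ hz => Branch.B_four hz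

lemma Q_four : IsPoly fun b => b.Q 4 :=
  (z_mul_disc_inv.mul ((((((const 6250).mul Q_three).add ((const 4375).mul Q_two)).add
    ((const 1250).mul Q_one)).add ((const 120).mul Q_zero)).add (const (15 / 4)))).congr
    fun _ _ hz => Branch.Q_four hz.1

/-- The generators of `polyRing` have derivatives in `polyRing`: the only relations needed are
the Picard–Fuchs equations for `B₄`, `Q₄` and the special geometry relation for `θ A₁`. -/
lemma exists_hasDz_generator (i : Fin 10) :
    ∃ f', IsPoly f' ∧ ∀ b, ∀ z ∈ b.dom, HasDz (b.generator i) (f' b z) z := by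
  have hB : ∀ {p}, IsPoly (fun b => b.B p) → IsPoly (fun b => b.B (p + 1)) →
      ∃ f', IsPoly f' ∧ ∀ b, ∀ z ∈ b.dom, HasDz (b.B p) (f' b z) z := fun h h' =>
    ⟨_, (h'.sub (B_one.mul h)).div_z, fun b z hz => Branch.hasDz_B hz _⟩
  have hQ : ∀ {p}, IsPoly (fun b => b.Q p) → IsPoly (fun b => b.Q (p + 1)) →
      ∃ f', IsPoly f' ∧ ∀ b, ∀ z ∈ b.dom, HasDz (b.Q p) (f' b z) z := fun h h' =>
    ⟨_, ((h.mul (const 2⁻¹)).add h').div_z, fun b z hz => Branch.hasDz_Q hz.1 _⟩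
  have hC : IsPoly fun _ z => 3125 * z / (1 - 3125 * z) := ((const 3125).mul z).mul disc_inv
  fin_cases i
  · have hr := (A_one.add (const 1)).add ((const 2).mul B_one)
    exact ⟨_, (((((const 2).mul ((B_one.mul hr).sub B_two)).add
      (z_mul_disc_inv.mul (((const 3125).mul hr).add (const 1250)))).sub (hr.pow 2)).sub
      ((const 2).mul (B_two.sub (B_one.pow 2)))).div_z, fun b z hz => Branch.hasDz_A_one hz⟩
  · exact hB B_one B_two
  · exact hB B_two B_three
  · exact hB B_three B_four
  · exact hQ Q_zero Q_one
  · exact hQ Q_one Q_two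
  · exact hQ Q_two Q_three
  · exact hQ Q_three Q_four
  · exact ⟨_, ((R₁.mul (((hC.sub (const (1 / 2))).sub B_one).sub A_one)).add R₂).div_z,
      fun b z hz => Branch.hasDz_R₁ hz⟩
  · exact ⟨_, (R₂.mul ((hC.add (const (1 / 2))).sub B_one)).div_z,
      fun b z hz => Branch.hasDz_R₂ hz⟩

lemma exists_hasDz (hf : IsPoly f) :
    ∃ f', IsPoly f' ∧ ∀ b, ∀ z ∈ b.dom, HasDz (f b) (f' b z) z := by
  obtain ⟨g, hg, e⟩ := hf
  suffices h : ∃ f', IsPoly f' ∧ ∀ b, ∀ z ∈ b.dom, HasDz (g b) (f' b z) z by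
    obtain ⟨f', h1, h2⟩ := h
    refine ⟨f', h1, fun b z hz => (h2 b z hz).congr ?_⟩
    filter_upwards [Branch.isOpen_dom.mem_nhds hz] with w hw using e b w hw
  clear e
  induction hg using Algebra.adjoin_induction with
  | mem x hx =>
    rcases hx with (rfl | rfl | rfl) | ⟨i, rfl⟩
    · exact ⟨_, const 1, fun b z _ => hasDz_of_hasDerivAt (hasDerivAt_id z)⟩
    · refine ⟨_, (z_inv.pow 2).neg, fun b z hz => hasDz_of_hasDerivAt ?_⟩
      simpa using hasDerivAt_inv (Branch.ne_zero_of_mem hz.1)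
    · refine ⟨_, ((const 3125).mul (disc_inv.pow 2)), fun b z hz => hasDz_of_hasDerivAt ?_⟩
      refine ((((hasDerivAt_id z).const_mul (3125 : ℂ)).const_sub 1).inv
        (Branch.disc_ne_zero hz.1)).congr_deriv ?_
      simp [div_eq_mul_inv]
    · exact exists_hasDz_generator i
  | algebraMap r => exact ⟨_, const 0, fun b z _ => hasDz_const r z⟩
  | add x y hx hy ihx ihy =>
    obtain ⟨x', hx', dx⟩ := ihx
    obtain ⟨y', hy', dy⟩ := ihy
    exact ⟨_, hx'.add hy', fun b z hz => (dx b z hz).add (dy b z hz)⟩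
  | mul x y hx hy ihx ihy =>
    obtain ⟨x', hx', dx⟩ := ihx
    obtain ⟨y', hy', dy⟩ := ihy
    have px : IsPoly x := ⟨x, hx, fun _ _ _ => rfl⟩
    have py : IsPoly y := ⟨y, hy, fun _ _ _ => rfl⟩
    exact ⟨_, (hx'.mul py).add (px.mul hy'), fun b z hz => (dx b z hz).mul (dy b z hz)⟩

lemma hasDz (hf : IsPoly f) {b : Branch} {z : ℂ} (hz : z ∈ b.dom) :
    HasDz (f b) (OpenBModel.dz (f b) z) z := by
  obtain ⟨f', _, h⟩ := hf.exists_hasDz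
  rw [(h b z hz).dz]
  exact h b z hz

lemma dz (hf : IsPoly f) : IsPoly fun b => dz (f b) := by
  obtain ⟨f', h1, h⟩ := hf.exists_hasDz
  exact h1.congr fun b z hz => (h b z hz).dz

end IsPoly

/-! ### Comparison with the ring `I` -/

lemma ratFunc_eval_div {p q : Polynomial ℂ} {z : ℂ} (hq : q.eval z ≠ 0) :
    (algebraMap _ (RatFunc ℂ) p / algebraMap _ (RatFunc ℂ) q).eval (RingHom.id ℂ) z
      = p.eval z / q.eval z := by
  have hq0 : q ≠ 0 := fun h => by simp [h] at hq
  set r := algebraMap _ (RatFunc ℂ) p / algebraMap _ (RatFunc ℂ) q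
  have h1 : r.denom.eval z ≠ 0 := fun h =>
    hq (Polynomial.eval_eq_zero_of_dvd_of_eval_eq_zero (RatFunc.denom_div_dvd p q) h)
  have h2 : r.num * q = p * r.denom := (RatFunc.num_mul_eq_mul_denom_iff hq0).2 rfl
  have h3 := congrArg (Polynomial.eval z) h2
  simp only [Polynomial.eval_mul] at h3
  rw [RatFunc.eval, Polynomial.eval₂_id, Polynomial.eval₂_id, div_eq_div_iff h1 hq, h3]

/-- Clearing denominators: an element of `polyRing` is a polynomial in the generators over `ℂ[z]`
divided by a power of `z (1 - 5⁵ z)`. -/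
lemma exists_mvPolynomial {g : Branch → ℂ → ℂ} (hg : g ∈ polyRing) :
    ∃ (p : MvPolynomial (Fin 10) (Polynomial ℂ)) (k : ℕ), ∀ b : Branch, ∀ z ∈ b.dom,
      (z * (1 - 3125 * z)) ^ k * g b z
        = p.eval₂ (Polynomial.evalRingHom z) (fun i => b.generator i z) := by
  induction hg using Algebra.adjoin_induction with
  | mem x hx =>
    rcases hx with (rfl | rfl | rfl) | ⟨i, rfl⟩
    · exact ⟨.C .X, 0, fun b z _ => by simp⟩
    · refine ⟨.C (1 - .C 3125 * .X), 1, fun b z hz => ?_⟩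
      have := Branch.ne_zero_of_mem hz.1
      simp
      field_simp
    · refine ⟨.C .X, 1, fun b z hz => ?_⟩
      have := Branch.disc_ne_zero hz.1
      simp
      rw [mul_inv_cancel_right₀ this]
    · exact ⟨.X i, 0, fun b z _ => by simp⟩
  | algebraMap r => exact ⟨.C (.C r), 0, fun b z _ => by simp⟩
  | add x y hx hy ihx ihy =>
    obtain ⟨p, k, hp⟩ := ihx
    obtain ⟨q, l, hq⟩ := ihy
    refine ⟨.C ((.X * (1 - .C 3125 * .X)) ^ l) * p + .C ((.X * (1 - .C 3125 * .X)) ^ k) * q, k + l,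
      fun b z hz => ?_⟩
    simp only [MvPolynomial.eval₂_add, MvPolynomial.eval₂_mul, MvPolynomial.eval₂_C,
      ← hp b z hz, ← hq b z hz]
    simp
    ring
  | mul x y hx hy ihx ihy =>
    obtain ⟨p, k, hp⟩ := ihx
    obtain ⟨q, l, hq⟩ := ihy
    refine ⟨p * q, k + l, fun b z hz => ?_⟩
    rw [MvPolynomial.eval₂_mul, ← hp b z hz, ← hq b z hz, Pi.mul_apply, Pi.mul_apply]
    ring

lemma IsPoly.memI {f : Branch → ℂ → ℂ} (hf : IsPoly f) : MemI f := by
  classical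
  obtain ⟨g, hg, e⟩ := hf
  obtain ⟨p, k, hp⟩ := exists_mvPolynomial hg
  set s : Polynomial ℂ := (.X * (1 - .C 3125 * .X)) ^ k with hs
  set P : MvPolynomial (Fin 10) (RatFunc ℂ) :=
    .C (algebraMap _ (RatFunc ℂ) s)⁻¹ * p.map (algebraMap _ (RatFunc ℂ)) with hP
  have hcoeff : ∀ m, P.coeff m
      = algebraMap _ (RatFunc ℂ) (p.coeff m) / algebraMap _ (RatFunc ℂ) s := fun m => by
    rw [hP, MvPolynomial.coeff_C_mul, MvPolynomial.coeff_map, div_eq_mul_inv, mul_comm]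
  refine ⟨P, fun b z hz _ => ?_⟩
  have hz0 := Branch.ne_zero_of_mem hz.1
  have hd := Branch.disc_ne_zero hz.1
  have hsz : s.eval z = (z * (1 - 3125 * z)) ^ k := by simp [hs]
  have hs0 : s.eval z ≠ 0 := by rw [hsz]; exact pow_ne_zero _ (mul_ne_zero hz0 hd)
  have hsub : P.support ⊆ p.support := fun m hm => by
    rw [MvPolynomial.mem_support_iff] at hm ⊢
    exact fun h => hm (by rw [hcoeff, h, map_zero, zero_div])
  rw [e b z hz, Branch.evalPoly, Finset.sum_subset hsub fun m _ hm => by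
    rw [MvPolynomial.notMem_support_iff.1 hm]; simp]
  have h := hp b z hz
  rw [← hsz, MvPolynomial.eval₂_eq'] at h
  refine mul_left_cancel₀ hs0 (h.trans ?_)
  rw [Finset.mul_sum]
  refine Finset.sum_congr rfl fun m _ => ?_
  rw [hcoeff, ratFunc_eval_div hs0, Polynomial.coe_evalRingHom]
  field_simp

/-! ### Half-integral powers of `z` and covariant derivatives -/

/-- `f ∈ z^{h/2} I`, in the strong sense of `IsPoly`. As `z` is invertible, this is the condition
`z^{h/2} f ∈ I`. -/
def IsHalf (h : ℕ) (f : Branch → ℂ → ℂ) : Prop := IsPoly fun b z => b.sqrtz z ^ h * f b z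

lemma IsPoly.isHalf {f : Branch → ℂ → ℂ} (hf : IsPoly f) : IsHalf 0 f := by
  simpa [IsHalf] using hf

namespace IsHalf

variable {f g : Branch → ℂ → ℂ} {h k : ℕ}

lemma isPoly (hf : IsHalf 0 f) : IsPoly f := by simpa [IsHalf] using hf

lemma congr (hf : IsHalf h f) (e : ∀ b, ∀ z ∈ b.dom, g b z = f b z) : IsHalf h g :=
  IsPoly.congr hf fun b z hz => by rw [e b z hz]

lemma zero : IsHalf h fun _ _ => 0 := by simpa [IsHalf] using IsPoly.const 0

lemma add (hf : IsHalf h f) (hg : IsHalf h g) : IsHalf h fun b z => f b z + g b z :=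
  (IsPoly.add hf hg).congr fun _ _ _ => by ring

lemma mul (hf : IsHalf h f) (hg : IsHalf k g) : IsHalf (h + k) fun b z => f b z * g b z :=
  (IsPoly.mul hf hg).congr fun _ _ _ => by ring

lemma mul_isPoly (hf : IsHalf h f) (hg : IsPoly g) : IsHalf h fun b z => f b z * g b z :=
  hf.mul hg.isHalf

lemma neg (hf : IsHalf h f) : IsHalf h fun b z => -f b z :=
  (IsPoly.neg hf).congr fun _ _ _ => by ring

lemma sub (hf : IsHalf h f) (hg : IsHalf h g) : IsHalf h fun b z => f b z - g b z :=
  (hf.add hg.neg).congr fun _ _ _ => sub_eq_add_neg _ _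

lemma pow (hf : IsHalf h f) (n : ℕ) : IsHalf (n * h) fun b z => f b z ^ n := by
  induction n with
  | zero => simpa using (IsPoly.const 1).isHalf
  | succ n ih => simpa only [pow_succ, add_mul, one_mul] using ih.mul hf

lemma sum {ι : Type*} (s : Finset ι) {f : ι → Branch → ℂ → ℂ} (hf : ∀ i ∈ s, IsHalf h (f i)) :
    IsHalf h fun b z => ∑ i ∈ s, f i b z :=
  (IsPoly.sum s hf).congr fun b z _ => by rw [Finset.mul_sum]

lemma prod {ι : Type*} (s : Finset ι) {f : ι → Branch → ℂ → ℂ} {h : ι → ℕ}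
    (hf : ∀ i ∈ s, IsHalf (h i) (f i)) : IsHalf (∑ i ∈ s, h i) fun b z => ∏ i ∈ s, f i b z := by
  classical
  induction s using Finset.induction_on with
  | empty => simpa using (IsPoly.const 1).isHalf
  | insert a s ha ih =>
    simp only [Finset.sum_insert ha, Finset.prod_insert ha]
    exact (hf a (by simp)).mul (ih fun i hi => hf i (by simp [hi]))

lemma add_two (hf : IsHalf h f) : IsHalf (h + 2) f :=
  (IsPoly.mul IsPoly.z hf).congr fun b z hz => by
    rw [pow_add, Branch.sqrtz_sq hz.1]; ring

lemma add_two_mul (hf : IsHalf h f) (k : ℕ) : IsHalf (h + 2 * k) f := by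
  induction k with
  | zero => exact hf
  | succ k ih => exact ih.add_two

/-- `f = z^{h/2} q` with `q` in the ring. -/
lemma exists_eq (hf : IsHalf h f) :
    ∃ q, IsPoly q ∧ ∀ b, ∀ z ∈ b.dom, f b z = b.sqrtz z ^ h * q b z := by
  refine ⟨_, (IsPoly.z_inv.pow h).mul hf, fun b z hz => ?_⟩
  have h0 := Branch.sqrtz_ne_zero hz.1
  have : z ^ h = b.sqrtz z ^ h * b.sqrtz z ^ h := by
    rw [← mul_pow, ← sq, Branch.sqrtz_sq hz.1]
  rw [inv_pow, this]
  field_simp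

lemma dz (hf : IsHalf h f) : IsHalf h fun b => dz (f b) := by
  obtain ⟨q, hq, e⟩ := hf.exists_eq
  have hd : ∀ b, ∀ z ∈ b.dom, OpenBModel.dz (f b) z
      = b.sqrtz z ^ h * (h / 2 * (q b z / z) + OpenBModel.dz (q b) z) := fun b z hz => by
    have h1 := (((Branch.hasDz_sqrtz hz.1).pow h).mul (hq.hasDz hz)).congr (g := f b) <| by
      filter_upwards [Branch.isOpen_dom.mem_nhds hz] with w hw using e b w hw
    rw [h1.dz]
    have hz0 := Branch.ne_zero_of_mem hz.1
    rcases h with _ | h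
    · simp
    · rw [Nat.add_sub_cancel, pow_succ]
      field_simp
  refine ((IsPoly.z.pow h).mul (((IsPoly.const (h / 2)).mul hq.div_z).add hq.dz)).congr
    fun b z hz => ?_
  have : z ^ h = b.sqrtz z ^ h * b.sqrtz z ^ h := by
    rw [← mul_pow, ← sq, Branch.sqrtz_sq hz.1]
  simp only [hd b z hz, this]
  ring

lemma memHalfPowI (hf : IsHalf h f) : MemHalfPowI h f :=
  let ⟨q, hq, e⟩ := hf.exists_eq; ⟨q, hq.memI, e⟩

end IsHalf

namespace IsPoly

lemma dz_Kc : IsPoly fun b => OpenBModel.dz b.Kc :=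
  B_one.neg.div_z.congr fun _ _ hz => Branch.dz_Kc hz

lemma dlogG : IsPoly fun b z => OpenBModel.dz b.G z / b.G z :=
  A_one.div_z.congr fun b z hz => by
    have := Branch.G_ne_zero hz
    rw [Branch.dz_G hz]
    field_simp

lemma Γ : IsPoly fun b => b.Γ := dlogG.congr fun _ _ _ => by rw [Branch.Γ, mul_comm, div_eq_mul_inv]

end IsPoly

lemma IsHalf.D {f : Branch → ℂ → ℂ} {h : ℕ} (hf : IsHalf h f) (m n : ℤ) :
    IsHalf h fun b => b.D m n (f b) :=
  ((hf.dz.add (hf.mul_isPoly ((IsPoly.const m).mul IsPoly.Γ))).add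
    (hf.mul_isPoly ((IsPoly.const n).mul IsPoly.dz_Kc.neg))).congr fun b z _ => by
      rw [Branch.D]; ring

namespace IsPoly

lemma D {f : Branch → ℂ → ℂ} (hf : IsPoly f) (m n : ℤ) : IsPoly fun b => b.D m n (f b) :=
  (hf.isHalf.D m n).isPoly

lemma Czzz : IsPoly fun _ => Czzz :=
  (((const 5).mul disc_inv).mul (z_inv.pow 3)).congr fun _ z _ => by
    rw [OpenBModel.Czzz]
    norm_num
    field_simp

lemma one_div_Czzz : IsPoly fun _ z => 1 / OpenBModel.Czzz z :=
  ((const (1 / 5)).mul (((const 1).sub ((const 3125).mul z)).mul (z.pow 3))).congr fun _ z _ => by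
    rw [OpenBModel.Czzz]
    norm_num
    field_simp

/-! ### Propagators, terminators and initial amplitudes -/

lemma dlogKf : IsPoly fun b => b.dlogKf :=
  (dz_Kc.add ((const (-1 / 5)).mul z_inv)).congr fun _ z _ => by
    rw [Branch.dlogKf]; field_simp

lemma dlogv : IsPoly fun _ => Branch.dlogv :=
  ((const (6 / 5)).mul z_inv).congr fun _ z _ => by rw [Branch.dlogv]; field_simp

lemma Szz : IsPoly fun b => b.Szz :=
  one_div_Czzz.mul (((const 2).mul dlogKf).sub (dlogv.add dlogG))

lemma Sz : IsPoly fun b => b.Sz :=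
  one_div_Czzz.mul ((dlogKf.pow 2).sub ((dlogv.mul dlogKf).add dlogKf.dz))

lemma S : IsPoly fun b => b.S :=
  ((((Sz.sub ((const (1 / 2)).mul (Szz.D 2 2))).sub
    (((const (1 / 2)).mul (Szz.pow 2)).mul Czzz)).mul dlogKf).add
    ((const (1 / 2)).mul (Sz.D 1 2))).add ((((const (1 / 2)).mul Szz).mul Sz).mul Czzz)

lemma F10 : IsPoly fun b => b.F10 :=
  (const (1 / 2)).mul (((((const (4 - χ / 12)).mul dz_Kc).sub dlogG).add
    ((const (-1 / 6)).mul (((const (-5 ^ 5)).mul disc_inv).congr fun _ z _ => by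
      norm_num [div_eq_mul_inv]))).add
    ((const (-1 - c₂H / 12)).mul (z_inv.congr fun _ _ _ => one_div _)))

end IsPoly

namespace IsHalf

lemma T : IsHalf 1 fun b => b.T := IsPoly.Q_zero.congr fun _ _ _ => by rw [pow_one]; rfl

lemma Δzz : IsHalf 1 fun b => b.Δzz := by
  refine ((T.D 0 (-1)).D (-1) (-1)).sub (IsPoly.congr (IsPoly.R₁.mul (IsPoly.z_inv.pow 2)) ?_)
  intro b z hz
  have hz0 := Branch.ne_zero_of_mem hz.1
  have e : b.sqrtz z ^ 5 = b.sqrtz z * z ^ 2 := by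
    nth_rw 3 [← Branch.sqrtz_sq hz.1]; ring
  rw [Branch.R₁, e]
  field_simp

lemma Δz : IsHalf 1 fun b => b.Δz :=
  (Δzz.neg.mul_isPoly IsPoly.one_div_Czzz).congr fun b z _ => by rw [Branch.Δz]; ring

lemma Δ : IsHalf 1 fun b => b.Δ := Δz.D 1 1

lemma F02 : IsHalf 2 fun b => b.F02 := by
  have hp : IsPoly fun (b : Branch) z =>
      N / 2 * OpenBModel.dz b.Kc z + 75 / (2 * (1 - 5 ^ 5 * z)) :=
    ((IsPoly.const (N / 2)).mul IsPoly.dz_Kc).add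
      (((IsPoly.const (75 / 2)).mul IsPoly.disc_inv).congr fun _ z _ => by norm_num; field_simp)
  exact (((Δzz.neg.mul Δz).sub ((Δz.mul Δz).mul_isPoly ((IsPoly.const (1 / 2)).mul
    IsPoly.Czzz))).add hp.isHalf.add_two).congr fun b z _ => by rw [Branch.F02]; ring

/-- If `𝓕^{(g,h)}` lies in `z^{h/2} I`, then so do all `𝓕^{(g,h)}_n`. -/
lemma amp {F : Branch → ℕ → ℕ → ℂ → ℂ} {g h : ℕ}
    (hF : 3 ≤ 2 * g + h → IsHalf h fun b => F b g h) (n : ℕ) :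
    IsHalf h fun b => b.amp (F b) g h n := by
  induction n with
  | zero =>
    simp only [Branch.amp]
    split_ifs with h3
    · exact hF h3
    · exact zero
  | succ n ih =>
    simp only [Branch.amp]
    split_ifs with h1 h2 h3 h4 h5
    · exact zero
    · rw [h2.2.1]; exact IsPoly.Czzz.isHalf
    · rw [h3.2.1]; exact Δzz
    · rw [h4.2.1]; exact IsPoly.F10.isHalf
    · rw [h5.2.1]; exact F02
    · exact ih.D _ _

lemma vertexFactor {F : Branch → ℕ → ℕ → ℂ → ℂ} {g h : ℕ}
    (hF : 3 ≤ 2 * g + h → IsHalf h fun b => F b g h) (n m : ℕ) :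
    IsHalf h fun b => b.vertexFactor (F b) g h n m := by
  induction m with
  | zero =>
    simp only [Branch.vertexFactor]
    split_ifs
    · exact amp hF n
    · exact zero
  | succ m ih =>
    simp only [Branch.vertexFactor]
    split_ifs with h1 h2
    · rw [h1.2.1]; exact (IsPoly.const (-N / 2)).isHalf.add_two
    · rw [h2.2.1]; exact (IsPoly.const (χ / 24 - 1)).isHalf
    · exact (ih.mul_isPoly (IsPoly.const (2 * (g : ℂ) - 2 + h + n + m))).congr
        fun _ _ _ => mul_comm _ _

lemma ambiguity {g h : ℕ} {f : Branch → ℂ → ℂ} (hf : IsAmbiguity g h f) : IsHalf h f := by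
  have hd : ∀ (k : ℕ) (z : ℂ), (1 - 3125 * z)⁻¹ ^ k = ((1 - 5 ^ 5 * z) ^ k)⁻¹ := fun k z => by
    rw [inv_pow]; norm_num
  unfold IsAmbiguity at hf
  split_ifs at hf with h0 h1
  · obtain ⟨a, c, -, -, e⟩ := hf
    subst h0
    exact (((IsPoly.polynomial a).mul (IsPoly.disc_inv.pow (2 * g - 2))).add
      (IsPoly.polynomial c)).isHalf.congr fun b z hz => by rw [e b z hz, hd, div_eq_mul_inv]
  · obtain ⟨a, -, e⟩ := hf
    obtain ⟨k, rfl⟩ := h1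
    have := (((IsPoly.polynomial a).mul
      (IsPoly.disc_inv.pow (2 * g + (k + k) - 2))).isHalf.add_two_mul k)
    rw [zero_add, two_mul] at this
    exact this.congr fun b z hz => by rw [e b z hz, hd, div_eq_mul_inv]
  · obtain ⟨a, -, e⟩ := hf
    obtain ⟨k, rfl⟩ := Nat.not_even_iff_odd.1 h1
    have hs : IsHalf 1 fun b => b.sqrtz := IsPoly.z.congr fun b z hz => by
      rw [pow_one, ← sq, Branch.sqrtz_sq hz.1]
    have := (hs.mul_isPoly ((IsPoly.polynomial a).mul
      (IsPoly.disc_inv.pow (2 * g + (2 * k + 1) - 2)))).add_two_mul k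
    rw [add_comm] at this
    exact this.congr fun b z hz => by rw [e b z hz, hd, div_eq_mul_inv, mul_assoc]

end IsHalf

/-! ### Finiteness of the set of Feynman diagrams -/

lemma sum_sym2_ends {α : Type*} [Fintype α] [DecidableEq α] (e : Sym2 α) :
    ∑ v, ((if v ∈ e then 1 else 0) + (if e = s(v, v) then 1 else 0)) = 2 := by
  induction e with
  | _ a c =>
    by_cases hac : a = c
    · subst hac
      have : ∀ v, (s(a, a) = s(v, v)) ↔ v = a := fun v => by simp [eq_comm]
      simp [Finset.sum_add_distrib, this]
    · have h1 : ∀ v, ¬ s(a, c) = s(v, v) := fun v h => by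
        simp only [Sym2.eq_iff] at h
        rcases h with ⟨h, h'⟩ | ⟨h, h'⟩ <;> exact hac (h.trans h'.symm)
      have h2 : ∀ v, (if v ∈ s(a, c) then 1 else 0)
          = (if v = a then 1 else 0) + (if v = c then 1 else 0) := fun v => by
        by_cases hv : v = a
        · subst hv; simp [hac]
        · simp [hv]
      simp only [h1, h2, if_false]
      simp [Finset.sum_add_distrib]

namespace Diagram

variable (A : Diagram)

lemma sum_card_ends {n k : ℕ} (j : Fin k → Sym2 (Fin n)) :
    ∑ v, ((Finset.univ.filter fun e => v ∈ j e).card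
      + (Finset.univ.filter fun e => j e = s(v, v)).card) = 2 * k := by
  simp only [Finset.card_filter, ← Finset.sum_add_distrib]
  rw [Finset.sum_comm]
  simp only [sum_sym2_ends]
  simp [mul_comm]

lemma sum_card_fiber {n k : ℕ} (j : Fin k → Fin n) :
    ∑ v, (Finset.univ.filter fun e => j e = v).card = k := by
  simp only [Finset.card_filter]
  rw [Finset.sum_comm]
  simp

lemma sum_nval : ∑ v, A.nval v = 2 * A.nIn₂ + A.nIn₁ + A.nOut₁ := by
  have h := sum_card_ends A.jIn₂
  simp only [nval]
  rw [Finset.sum_add_distrib, Finset.sum_add_distrib, h, sum_card_fiber fun e => (A.jIn₁ e).1,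
    sum_card_fiber]

lemma sum_mval : ∑ v, A.mval v = 2 * A.nIn₀ + A.nIn₁ + A.nOut₀ := by
  have h := sum_card_ends A.jIn₀
  simp only [mval]
  rw [Finset.sum_add_distrib, Finset.sum_add_distrib, h, sum_card_fiber fun e => (A.jIn₁ e).2,
    sum_card_fiber]

/-- The conditions on a diagram of `𝔾(g,h)` that do not refer to the amplitudes: stability of the
vertices replaces the condition that no vertex factor vanishes. -/
structure IsStable (g h : ℕ) : Prop where
  connected : A.skeleton.Connected
  stable : ∀ v, 3 ≤ 2 * (A.label v).1 + (A.label v).2 + A.nval v + A.mval v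
  genus : (∑ v, (A.label v).1) + (A.nIn₀ + A.nIn₁ + A.nIn₂) + 1 = g + A.nV
  boundaries : (∑ v, (A.label v).2) + (A.nOut₀ + A.nOut₁) = h
  val_pos : ∀ v, 0 < A.nval v + A.mval v

variable {A} {g h : ℕ}

/-- The Euler characteristics `2 - 2g - h - n` of the vertices add up. -/
lemma IsStable.sum_euler (hA : A.IsStable g h) :
    ∑ v, (2 * (A.label v).1 + (A.label v).2 + A.nval v + A.mval v - 2) + 2 = 2 * g + h := by
  have h1 : ∑ v, (2 * (A.label v).1 + (A.label v).2 + A.nval v + A.mval v)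
      = 2 * ∑ v, (A.label v).1 + ∑ v, (A.label v).2 + (2 * A.nIn₂ + A.nIn₁ + A.nOut₁)
        + (2 * A.nIn₀ + A.nIn₁ + A.nOut₀) := by
    rw [Finset.sum_add_distrib, Finset.sum_add_distrib, Finset.sum_add_distrib, ← Finset.mul_sum,
      sum_nval, sum_mval]
  have h2 : ∑ v, (2 * (A.label v).1 + (A.label v).2 + A.nval v + A.mval v)
      = ∑ v, (2 * (A.label v).1 + (A.label v).2 + A.nval v + A.mval v - 2) + 2 * A.nV := by
    have : 2 * A.nV = ∑ _v : Fin A.nV, 2 := by simp [mul_comm]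
    rw [this, ← Finset.sum_add_distrib]
    exact Finset.sum_congr rfl fun v _ => by have := hA.stable v; omega
  have h3 := hA.genus
  have h4 := hA.boundaries
  omega

lemma IsStable.euler_le (hA : A.IsStable g h) (v : Fin A.nV) :
    2 * (A.label v).1 + (A.label v).2 + A.nval v + A.mval v ≤ 2 * g + h := by
  have h1 := Finset.single_le_sum (f := fun v => 2 * (A.label v).1 + (A.label v).2 + A.nval v
    + A.mval v - 2) (fun _ _ => Nat.zero_le _) (Finset.mem_univ v)
  have h2 := hA.sum_euler
  omega

/-- Every vertex of a stable diagram is labelled by a simpler surface. -/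
lemma IsStable.label_lt (hA : A.IsStable g h) (v : Fin A.nV) :
    2 * (A.label v).1 + (A.label v).2 < 2 * g + h := by
  have := hA.euler_le v
  have := hA.val_pos v
  omega

lemma IsStable.nV_le (hA : A.IsStable g h) : A.nV ≤ 2 * g + h := by
  have h1 : ∑ _v : Fin A.nV, 1
      ≤ ∑ v, (2 * (A.label v).1 + (A.label v).2 + A.nval v + A.mval v - 2) :=
    Finset.sum_le_sum fun v _ => by have := hA.stable v; omega
  have h2 := hA.sum_euler
  simp at h1
  omega

lemma finite_setOf_le (M : ℕ) : {A : Diagram | A.nV ≤ M ∧ (∀ v, (A.label v).1 ≤ M) ∧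
    (∀ v, (A.label v).2 ≤ M) ∧ A.nIn₀ ≤ M ∧ A.nIn₁ ≤ M ∧ A.nIn₂ ≤ M ∧ A.nOut₀ ≤ M ∧
    A.nOut₁ ≤ M}.Finite := by
  let Data : Type := Σ n : Fin 6 → Fin (M + 1), (Fin (n 0) → Fin (M + 1) × Fin (M + 1)) ×
    (Fin (n 1) → Sym2 (Fin (n 0))) × (Fin (n 2) → Fin (n 0) × Fin (n 0)) ×
    (Fin (n 3) → Sym2 (Fin (n 0))) × (Fin (n 4) → Fin (n 0)) × (Fin (n 5) → Fin (n 0))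
  let toDiagram : Data → Diagram := fun x =>
    ⟨x.1 0, fun v => ((x.2.1 v).1, (x.2.1 v).2), x.1 1, x.1 2, x.1 3, x.1 4, x.1 5,
      x.2.2.1, x.2.2.2.1, x.2.2.2.2.1, x.2.2.2.2.2.1, x.2.2.2.2.2.2⟩
  refine (Set.finite_range toDiagram).subset ?_
  rintro ⟨nV, label, n0, n1, n2, o0, o1, j0, j1, j2, k0, k1⟩ ⟨hV, hl1, hl2, h0, h1, h2, h3, h4⟩
  simp only at hV hl1 hl2 h0 h1 h2 h3 h4
  exact ⟨⟨![⟨nV, by omega⟩, ⟨n0, by omega⟩, ⟨n1, by omega⟩, ⟨n2, by omega⟩, ⟨o0, by omega⟩,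
    ⟨o1, by omega⟩], fun v => (⟨(label v).1, by have := hl1 v; omega⟩,
    ⟨(label v).2, by have := hl2 v; omega⟩), j0, j1, j2, k0, k1⟩, rfl⟩

lemma finite_isStable (g h : ℕ) : {A : Diagram | A.IsStable g h}.Finite := by
  refine (finite_setOf_le (3 * g + h)).subset fun A hA => ?_
  have h1 := hA.nV_le
  have h2 := hA.genus
  have h3 := hA.boundaries
  exact ⟨by omega, fun v => by have := hA.label_lt v; omega,
    fun v => by have := hA.label_lt v; omega, by omega, by omega, by omega, by omega, by omega⟩

lemma finite_isoClass (g h : ℕ) : {G : IsoClass | (Quotient.out G).IsStable g h}.Finite :=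
  (finite_isStable g h).preimage (Quotient.out_injective.injOn)

end Diagram

lemma Branch.vertexFactor_eq_zero (b : Branch) (F : ℕ → ℕ → ℂ → ℂ) {g h n m : ℕ}
    (hs : 2 * g + h + n + m < 3) : b.vertexFactor F g h n m = 0 := by
  induction m with
  | zero =>
    simp only [vertexFactor]
    exact if_neg (by omega)
  | succ m ih =>
    simp only [vertexFactor]
    rw [if_neg (by omega), if_neg (by omega), ih (by omega)]
    funext z
    simp

namespace Diagram

variable {A : Diagram} {g h : ℕ} {b : Branch} {F : ℕ → ℕ → ℂ → ℂ}

lemma IsMem.isStable (hA : A.IsMem b F g h) : A.IsStable g h where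
  connected := hA.connected
  stable v := by
    by_contra hlt
    obtain ⟨z, -, hz⟩ := hA.vertex_ne_zero v
    exact hz (congrFun (b.vertexFactor_eq_zero F (not_le.1 hlt)) z)
  genus := hA.genus
  boundaries := hA.boundaries
  val_pos := hA.val_pos

/-- Stable diagrams outside `𝔾(g,h)` do not contribute. -/
lemma IsStable.value_eq_zero (hA : A.IsStable g h) (hn : ¬ A.IsMem b F g h) {z : ℂ}
    (hz : z ∈ b.dom) : A.value b F z = 0 := by
  have : ∃ v, A.vertexValue b F v z = 0 := by
    by_contra! hne
    exact hn ⟨hA.connected, fun v => ⟨z, hz, hne v⟩, hA.genus, hA.boundaries, hA.val_pos⟩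
  obtain ⟨v, hv⟩ := this
  rw [value, Finset.prod_eq_zero (Finset.mem_univ v) hv]
  simp

end Diagram

/-- The Feynman sum as a sum over a finite set of diagrams which is the same for all branches. -/
lemma feynmanSum_eq (b : Branch) (F : ℕ → ℕ → ℂ → ℂ) (g h : ℕ) {z : ℂ} (hz : z ∈ b.dom) :
    feynmanSum b F g h z = -∑ G ∈ (Diagram.finite_isoClass g h).toFinset,
      1 / ((Quotient.out G).symmetryFactor : ℂ) * (Quotient.out G).value b F z := by
  classical
  rw [feynmanSum, finsum_eq_sum_of_support_subset (s := (Diagram.finite_isoClass g h).toFinset)]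
  · congr 1
    refine Finset.sum_congr rfl fun G hG => ?_
    have hG : (Quotient.out G).IsStable g h := (Diagram.finite_isoClass g h).mem_toFinset.1 hG
    by_cases hm : (Quotient.out G).IsMem b F g h
    · rw [finsum_eq_if, if_pos hm]
    · rw [finsum_eq_if, if_neg hm, hG.value_eq_zero hm hz, mul_zero]
  · intro G hG
    rw [Set.Finite.coe_toFinset]
    by_contra hn
    refine hG ?_
    exact finsum_eq_if.trans (if_neg fun hm => hn (Diagram.IsMem.isStable hm))

/-! ### The amplitudes -/

lemma IsHalf.value {F : Branch → ℕ → ℕ → ℂ → ℂ} {A : Diagram} {g h : ℕ} (hA : A.IsStable g h)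
    (hF : ∀ v, 3 ≤ 2 * (A.label v).1 + (A.label v).2 →
      IsHalf (A.label v).2 fun b => F b (A.label v).1 (A.label v).2) :
    IsHalf h fun b => A.value b (F b) := by
  have h1 : IsHalf (∑ v, (A.label v).2) fun b z => ∏ v, A.vertexValue b (F b) v z :=
    IsHalf.prod Finset.univ fun v _ => IsHalf.vertexFactor (hF v) (A.nval v) (A.mval v)
  have h2 := (((((h1.mul_isPoly (((IsPoly.const (-2)).mul IsPoly.S).pow A.nIn₀)).mul_isPoly
    (IsPoly.Sz.neg.pow A.nIn₁)).mul_isPoly (IsPoly.Szz.neg.pow A.nIn₂)).mul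
    (IsHalf.Δ.pow A.nOut₀)).mul (IsHalf.Δz.pow A.nOut₁))
  rw [mul_one, mul_one, add_assoc, hA.boundaries] at h2
  exact h2

/-- `𝓕^{(g,h)} ∈ z^{h/2} I`, by induction on `2g + h`. -/
lemma IsAmplitudeFamily.isHalf {F : Branch → ℕ → ℕ → ℂ → ℂ} (hF : IsAmplitudeFamily F) (g h : ℕ)
    (h3 : 3 ≤ 2 * g + h) : IsHalf h fun b => F b g h := by
  induction hk : 2 * g + h using Nat.strong_induction_on generalizing g h with
  | _ k ih =>
    obtain ⟨f, hf, e⟩ := hF g h h3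
    have hsum : IsHalf h fun b z => ∑ G ∈ (Diagram.finite_isoClass g h).toFinset,
        1 / ((Quotient.out G).symmetryFactor : ℂ) * (Quotient.out G).value b (F b) z := by
      refine IsHalf.sum _ fun G hG => ?_
      have hG : (Quotient.out G).IsStable g h := (Diagram.finite_isoClass g h).mem_toFinset.1 hG
      have hv := IsHalf.value hG fun v h3 => ih _ (hk ▸ hG.label_lt v) _ _ h3 rfl
      exact (hv.mul_isPoly (IsPoly.const _)).congr fun _ _ _ => mul_comm _ _
    exact (hsum.neg.add (IsHalf.ambiguity hf)).congr fun b z hz => by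
      rw [e b z hz, feynmanSum_eq b (F b) g h hz]

/-- The integral powers of `z³ C_{zzz}` have no poles in the moduli space. -/
lemma IsPoly.zpow_Czzz (n : ℤ) : IsPoly fun _ z => (z ^ 3 * OpenBModel.Czzz z) ^ n := by
  cases n with
  | ofNat n => simpa using ((IsPoly.z.pow 3).mul IsPoly.Czzz).pow n
  | negSucc n =>
    refine (((IsPoly.z_inv.pow 3).mul IsPoly.one_div_Czzz).pow (n + 1)).congr fun b z hz => ?_
    rw [zpow_negSucc, ← inv_pow, mul_inv, inv_pow, one_div]

end OpenBModel

theorem mainTheorem2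
    (F : OpenBModel.Branch → ℕ → ℕ → ℂ → ℂ)
    (hF : OpenBModel.IsAmplitudeFamily F) :
    (∀ g h n : ℕ, 3 ≤ 2 * g + h + n →
      OpenBModel.MemHalfPowI h (OpenBModel.amplitude F g h n)) ∧
    (∀ g h n : ℕ, OpenBModel.MemI (OpenBModel.P F g h n)) := by
  have key : ∀ g h n : ℕ, OpenBModel.IsHalf h (OpenBModel.amplitude F g h n) := fun g h n =>
    OpenBModel.IsHalf.amp (hF.isHalf g h) n
  refine ⟨fun g h n _ => (key g h n).memHalfPowI, fun g h n => OpenBModel.IsPoly.memI ?_⟩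
  by_cases h3 : 3 ≤ 2 * g + h + n
  · refine ((OpenBModel.IsPoly.zpow_Czzz ((g : ℤ) + h - 1)).mul (key g h n)).congr fun b z _ => ?_
    rw [OpenBModel.P, if_pos h3, mul_assoc]
  · refine (OpenBModel.IsPoly.const 0).congr fun b z _ => ?_
    rw [OpenBModel.P, if_neg h3]
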